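/- **Setting.** A Turing machine has a finite state set $Q$, a finite symbol set $\Gamma$ with a blank, an initial state, a two-way infinite tape and a partial transition function $\delta : Q\times\Gamma \rightharpoonup Q\times\Gamma\times\{L,R\}$; it halts where $\delta$ is undefined. It is an $(m,n)$-*universal Turing machine* (UTM) if $|Q|=m$, $|\Gamma|=n$, and it simulates every Turing machine: there are primitive recursive maps $\mathrm{enc}$ and $\mathrm{dec}$ such that, for every Turing machine $P$ (given as a list of quintuples) and input word $w$, the machine started in its initial state on the finite tape content $\mathrm{enc}(P,w)$ halts if and only if $P$ halts on $w$, and then $\mathrm{dec}$ applied to its final tape content gives the halting configuration of $P$. **The game.** Consider a session of *Civilization: Beyond Earth* with one player, no turn limit, and an infinite hexagonal map. Workers build a Road (on any unimproved tile) in $M\ge 1$ turns and a Terrascape (on an unimproved tile owned by the player) in $T\ge 1$ turns, and repair or remove an improvement in one turn; a Rover pillages a Road in one turn; in each turn every unit may first move to an adjacent tile. Suppose that * there is a bi-infinite strip $(h_i)_{i\in\mathbb Z}$ of distinct, flat, traversable tiles with $h_i$ adjacent to $h_{i+1}$ (the tape); * there is a finite connected section of the map, disjoint from the strip, that consists of flat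 desert tiles owned by the player, and at least nine of its tiles are worked by Citizens; * the player has the technology for building Terrascapes, can maintain at least nine of them, and has the Ecoscaping civic ($+1$ Culture per Terrascape); * apart from Terrascapes the Culture yield per turn is a constant $C_*$. Let $u\ge 1$ be the Culture yield of a worked Terrascape on desert, and $C_t$ the Culture yield of turn $t$. Let the machine $\mathcal M$ have states $Q=\{0,\dots,9\}$, initial state $0$, symbols $\Gamma=\{\text{No Improvement},\text{Road},\text{Pillaged Road}\}$ (written $0,1,b$; blank $0$), and the following transitions, where "$a'\,D\,q'$" in row $q$ and column $a$ means: write $a'$, move to $D$, go to state $q'$. | $q$ | $0$ | $1$ | $b$ | |---|---|---|---| | 0 | $1R0$ | $0L1$ | $bR3$ | | 1 | $0L2$ | $0L1$ | $bL1$ | | 2 | $0L1$ | $bL5$ | $bR0$ | | 3 | $1R0$ | $1R4$ | $1L3$ | | 4 | $bL2$ | $1R4$ | $bR4$ | | 5 | $1L6$ | $1L5$ | $bL5$ | | 6 | $0R7$ | HALT | $bL8$ | | 7 | $1L5$ | $1R7$ | $bR7$ | | 8 | $1L9$ | $0R9$ | $0L3$ | | 9 | $0R4$ | $0R9$ | $bR8$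 | In the game, an entry is the command: the tape Worker and the Rover change the tile under them as prescribed (build, remove or repair a Road; pillage it; build and pillage it; or leave the tile as it is) and move one tile along the strip in direction $D$, and the state Worker builds $q'-q$ Terrascapes, or removes $q-q'$. A game state *represents* a configuration of $\mathcal M$ if the normalized Culture yield $(C_t-C_*)/u$ is its state, the improvement on $h_i$ is its $i$-th tape symbol for every $i$, the tape Worker and the Rover are on the tile of the head, and the state Worker is in the state section, whose worked tiles carry only Terrascapes or nothing and which are the only tiles with Terrascapes. **Theorem.** Under these assumptions: 1. $\mathcal M$ is a $(10,3)$-universal Turing machine. 2. The command table corresponds, entry by entry, to the program above of Rogozhin's $(10,3)$-machine over $\{0,1,b\}$, under No Improvement $\mapsto 0$, Road $\mapsto 1$, Pillaged Road $\mapsto b$. 3. Every initial configuration of $\mathcal M$ (state $0$, finite tape content) is represented by a game state in which the state section is unimproved. 4. There is a constant $K$, depending only on the session, such that whenever a game state represents a configuration $c$ of $\mathcal M$ and $\mathcal M$ steps from $c$ to $c'$, the player can reach, by legal turns in which the units only move or carry out the command of the table for $c$, a game state that represents $c'$, within at most $K$ turns, of which at most $5T+M$ are turns in which some unit works. -/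

import Mathlib

namespace CivBE

/-! ### Turing machines -/

/-- Head movements. -/
inductive Dir
  | L
  | R
  deriving DecidableEq

/-- The cell reached from cell `i`. -/
def Dir.shift : Dir → ℤ → ℤ
  | .L, i => i - 1
  | .R, i => i + 1

/-- A Turing machine with states `Q` and tape symbols `Γ`. The transition function is partial;
the machine halts where it is undefined (final states are states without transitions). -/
structure TuringMachine (Q Γ : Type) where
  δ : Q → Γ → Option (Q × Γ × Dir)
  blank : Γ
  start : Q

/-- A configuration: internal state, head position, content of the two-way infinite tape. -/
structure Cfg (Q Γ : Type) where
  state : Q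
  head : ℤ
  tape : ℤ → Γ

namespace TuringMachine

variable {Q Γ : Type}

/-- One step; `none` means that the machine has halted. -/
def step (M : TuringMachine Q Γ) (c : Cfg Q Γ) : Option (Cfg Q Γ) :=
  (M.δ c.state (c.tape c.head)).map fun (q, a, d) =>
    { state := q, head := d.shift c.head, tape := Function.update c.tape c.head a }

/-- The initial configuration on the finite tape content `x = (l, r)`: `r` is written from the head
rightwards (its first symbol is under the head), `l` from the cell left of the head leftwards, and
all the other cells are blank. -/
def init (M : TuringMachine Q Γ) (x : List Γ × List Γ) : Cfg Q Γ where
  state := M.start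
  head := 0
  tape i := if 0 ≤ i then x.2.getD i.toNat M.blank else x.1.getD (-i - 1).toNat M.blank

/-- The configuration `c` has the tape content `x = (l, r)` relative to its head. -/
def HasContent (M : TuringMachine Q Γ) (c : Cfg Q Γ) (x : List Γ × List Γ) : Prop :=
  ∀ i : ℕ, c.tape (c.head + i) = x.2.getD i M.blank ∧
    c.tape (c.head - 1 - i) = x.1.getD i M.blank

/-- `d` is the halting configuration that `M` reaches from `c`. -/
def HaltsAt (M : TuringMachine Q Γ) (c d : Cfg Q Γ) : Prop :=
  Relation.ReflTransGen (fun a b => M.step a = some b) c d ∧ M.step d = none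

end TuringMachine

/-- `Dir` as a two-element type. -/
def Dir.equivBool : Dir ≃ Bool where
  toFun
    | .L => false
    | .R => true
  invFun
    | false => .L
    | true => .R
  left_inv := by rintro (_ | _) <;> rfl
  right_inv := by rintro (_ | _) <;> rfl

instance : Primcodable Dir := Primcodable.ofEquiv Bool Dir.equivBool

/-- An arbitrary Turing machine as a finite object: a list of quintuples `((q, a), (q', a', d))`
(in state `q` reading `a`: go to state `q'`, write `a'`, move to `d`). States and symbols are
numbered; the initial state and the blank are numbered `0`. The first quintuple that
applies counts, and the machine halts when none does. -/
abbrev Program := List ((ℕ × ℕ) × (ℕ × ℕ × Dir))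

/-- The Turing machine described by a list of quintuples. -/
def Program.machine (p : Program) : TuringMachine ℕ ℕ where
  δ q a := p.lookup (q, a)
  blank := 0
  start := 0

/-- `U` simulates every Turing machine: a primitive recursive `enc` translates a machine `p` and an
input word `w` for it into a finite tape content for `U`, such that `U`, started there in its
initial state, halts if and only if `p` halts on `w`; and a primitive recursive `dec` then recovers
the halting configuration of `p` (state and tape content relative to the head) from the
tape content with which `U` halts. -/
def IsUniversal {Q Γ : Type} [Primcodable Γ] (U : TuringMachine Q Γ) : Prop :=
  ∃ (enc : Program × List ℕ → List Γ × List Γ)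
    (dec : List Γ × List Γ → ℕ × List ℕ × List ℕ),
    Primrec enc ∧ Primrec dec ∧
    ∀ (p : Program) (w : List ℕ),
      ((∃ d, U.HaltsAt (U.init (enc (p, w))) d) ↔
        ∃ c, p.machine.HaltsAt (p.machine.init ([], w)) c) ∧
      ∀ c d, p.machine.HaltsAt (p.machine.init ([], w)) c →
        U.HaltsAt (U.init (enc (p, w))) d →
        ∀ x, U.HasContent d x →
          c.state = (dec x).1 ∧ p.machine.HasContent c (dec x).2

/-- An `(m, n)`-universal Turing machine: `m` states, `n` tape symbols, universal. -/
def IsUTM (m n : ℕ) {Q Γ : Type} [Primcodable Γ] (U : TuringMachine Q Γ) : Prop :=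
  Nat.card Q = m ∧ Nat.card Γ = n ∧ IsUniversal U

/-! ### Rogozhin's machine -/

/-- Tape symbols of Rogozhin's machine. -/
inductive RSymbol
  | zero
  | one
  | b
  deriving DecidableEq

open Dir RSymbol in
/-- Rogozhin's program with 10 states and 3 symbols (blank `0`). -/
def rogozhin : TuringMachine (Fin 10) RSymbol where
  δ
    | 0, zero => some (0, one, R)
    | 0, one => some (1, zero, L)
    | 0, b => some (3, b, R)
    | 1, zero => some (2, zero, L)
    | 1, one => some (1, zero, L)
    | 1, b => some (1, b, L)
    | 2, zero => some (1, zero, L)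
    | 2, one => some (5, b, L)
    | 2, b => some (0, b, R)
    | 3, zero => some (0, one, R)
    | 3, one => some (4, one, R)
    | 3, b => some (3, one, L)
    | 4, zero => some (2, b, L)
    | 4, one => some (4, one, R)
    | 4, b => some (4, b, R)
    | 5, zero => some (6, one, L)
    | 5, one => some (5, one, L)
    | 5, b => some (5, b, L)
    | 6, zero => some (7, zero, R)
    | 6, one => none
    | 6, b => some (8, b, L)
    | 7, zero => some (5, one, L)
    | 7, one => some (7, one, R)
    | 7, b => some (7, b, R)
    | 8, zero => some (9, one, L)
    | 8, one => some (9, zero, R)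
    | 8, b => some (3, zero, L)
    | 9, zero => some (4, zero, R)
    | 9, one => some (9, zero, R)
    | 9, b => some (8, b, R)
  blank := zero
  start := 0

/-! ### The command table of the Civ:BE machine -/

/-- The tape symbols: what the head finds on a tile. -/
inductive TileSymbol
  | noImprovement
  | road
  | pillagedRoad
  deriving DecidableEq

/-- `TileSymbol` as a three-element type. -/
def TileSymbol.equivFin : TileSymbol ≃ Fin 3 where
  toFun
    | .noImprovement => 0
    | .road => 1
    | .pillagedRoad => 2
  invFun
    | 0 => .noImprovement
    | 1 => .road
    | 2 => .pillagedRoad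
  left_inv := by rintro (_ | _ | _) <;> rfl
  right_inv := by decide

instance : Primcodable TileSymbol := Primcodable.ofEquiv (Fin 3) TileSymbol.equivFin

/-- The correspondence of the tape symbols with those of Rogozhin's machine. -/
def TileSymbol.equivRSymbol : TileSymbol ≃ RSymbol where
  toFun
    | .noImprovement => .zero
    | .road => .one
    | .pillagedRoad => .b
  invFun
    | .zero => .noImprovement
    | .one => .road
    | .b => .pillagedRoad
  left_inv := by rintro (_ | _ | _) <;> rfl
  right_inv := by rintro (_ | _ | _) <;> rfl

/-- Commands to the tape Worker and the Rover, before they move. -/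
inductive TapeCommand
  | leave
  | buildRoad
  | buildRoadAndPillage
  | pillageRoad
  | repairRoad
  | removeImprovement

/-- Commands to the state Worker. -/
inductive StateCommand
  | noBuild
  | build (n : ℕ)
  | remove (n : ℕ)

/-- An entry of the command table. -/
structure Command where
  tape : TapeCommand
  dir : Dir
  state : StateCommand

/-- The symbol on the tile under the head after the command. -/
def TapeCommand.write : TapeCommand → TileSymbol → TileSymbol
  | .leave, a => a
  | .buildRoad, _ => .road
  | .buildRoadAndPillage, _ => .pillagedRoad
  | .pillageRoad, _ => .pillagedRoad
  | .repairRoad, _ => .road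
  | .removeImprovement, _ => .noImprovement

/-- The number of Terrascapes after the command. -/
def StateCommand.apply : StateCommand → Fin 10 → Fin 10
  | .noBuild, q => q
  | .build n, q => Fin.ofNat 10 (q.val + n)
  | .remove n, q => Fin.ofNat 10 (q.val - n)

open Dir TileSymbol TapeCommand StateCommand in
/-- The command table; `none` is HALT. -/
def table : Fin 10 → TileSymbol → Option Command
  | 0, noImprovement => some ⟨buildRoad, R, noBuild⟩
  | 0, road => some ⟨removeImprovement, L, build 1⟩
  | 0, pillagedRoad => some ⟨leave, R, build 3⟩
  | 1, noImprovement => some ⟨leave, L, build 1⟩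
  | 1, road => some ⟨removeImprovement, L, noBuild⟩
  | 1, pillagedRoad => some ⟨leave, L, noBuild⟩
  | 2, noImprovement => some ⟨leave, L, remove 1⟩
  | 2, road => some ⟨pillageRoad, L, build 3⟩
  | 2, pillagedRoad => some ⟨leave, R, remove 2⟩
  | 3, noImprovement => some ⟨buildRoad, R, remove 3⟩
  | 3, road => some ⟨leave, R, build 1⟩
  | 3, pillagedRoad => some ⟨repairRoad, L, noBuild⟩
  | 4, noImprovement => some ⟨buildRoadAndPillage, L, remove 2⟩
  | 4, road => some ⟨leave, R, noBuild⟩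
  | 4, pillagedRoad => some ⟨leave, R, noBuild⟩
  | 5, noImprovement => some ⟨buildRoad, L, build 1⟩
  | 5, road => some ⟨leave, L, noBuild⟩
  | 5, pillagedRoad => some ⟨leave, L, noBuild⟩
  | 6, noImprovement => some ⟨leave, R, build 1⟩
  | 6, road => none
  | 6, pillagedRoad => some ⟨leave, L, build 2⟩
  | 7, noImprovement => some ⟨buildRoad, L, remove 2⟩
  | 7, road => some ⟨leave, R, noBuild⟩
  | 7, pillagedRoad => some ⟨leave, R, noBuild⟩
  | 8, noImprovement => some ⟨buildRoad, L, build 1⟩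
  | 8, road => some ⟨removeImprovement, R, build 1⟩
  | 8, pillagedRoad => some ⟨removeImprovement, L, remove 5⟩
  | 9, noImprovement => some ⟨leave, R, remove 5⟩
  | 9, road => some ⟨removeImprovement, R, noBuild⟩
  | 9, pillagedRoad => some ⟨leave, R, remove 1⟩

/-- The Turing machine with states `0, …, 9` and symbols No Improvement, Road, Pillaged Road whose
transition function is given by the command table. -/
def civMachine : TuringMachine (Fin 10) TileSymbol where
  δ q a := (table q a).map fun k => (k.state.apply q, k.tape.write a, k.dir)
  blank := .noImprovement
  start := 0

/-! ### The game -/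

/-- Tiles of the infinite hexagonal map, in axial coordinates. -/
abbrev Tile := ℤ × ℤ

/-- Two hexes are adjacent. -/
def Adjacent (s t : Tile) : Prop :=
  (t.1 - s.1, t.2 - s.2) ∈
    ({(1, 0), (-1, 0), (0, 1), (0, -1), (1, -1), (-1, 1)} : Set (ℤ × ℤ))

/-- Geographical types. -/
inductive Terrain
  | desert
  | grassland
  | plains
  | tundra
  | snow
  | water
  deriving DecidableEq

/-- What stands on a tile. -/
inductive Improvement
  | none
  | road
  | pillagedRoad
  | terrascape
  deriving DecidableEq

/-- What Workers can build. -/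
inductive Build
  | road
  | terrascape
  deriving DecidableEq

/-- The finished improvement. -/
def Build.result : Build → Improvement
  | .road => .road
  | .terrascape => .terrascape

/-- The improvement that stands for a tape symbol. -/
def TileSymbol.improvement : TileSymbol → Improvement
  | .noImprovement => .none
  | .road => .road
  | .pillagedRoad => .pillagedRoad

/-- The data of a game session that do not change while the machine runs. -/
structure World where
  /-- geography -/
  terrain : Tile → Terrain
  /-- the flat tiles that units can enter -/
  traversable : Set Tile
  /-- the tiles owned by the player -/
  owned : Set Tile
  /-- the tiles worked by Citizens -/
  worked : Finset Tile
  /-- the section of the map reserved for the states -/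
  stateSection : Finset Tile
  /-- the strip of the map used as the tape -/
  strip : ℤ → Tile
  /-- turns needed to build a Road -/
  roadTurns : ℕ
  /-- turns needed to build a Terrascape -/
  terrascapeTurns : ℕ
  /-- the number of Terrascapes that the player can maintain -/
  maintainable : ℕ
  /-- the player has the technology that allows Terrascapes -/
  terraforming : Bool
  /-- the player has the civic that gives 1 Culture more for every Terrascape -/
  ecoscaping : Bool
  /-- Culture yield of a Terrascape without that civic, by terrain -/
  terrascapeCulture : Terrain → ℕ
  /-- base Culture yield per turn -/
  baseCulture : ℕ

/-- The part of the game that Workers change. `progress t k` is the number of turns of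
work already done on the unfinished `k` on tile `t`. -/
structure Board where
  improvement : Tile → Improvement
  progress : Tile → Build → ℕ

/-- A game state: the board and the positions of the two Workers and the Rover. -/
structure GameState where
  board : Board
  stateWorker : Tile
  tapeWorker : Tile
  rover : Tile

/-- What a Worker can do in a turn, after moving. -/
inductive Job
  | idle
  | build (k : Build)
  | repair
  | remove
  deriving DecidableEq

/-- The orders of the player in a turn (apart from the moves). -/
structure Orders where
  stateWorker : Job
  tapeWorker : Job
  pillage : Bool

/-- Some unit works in the turn (otherwise the units only move). -/
def Orders.isWork (o : Orders) : Bool :=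
  o.stateWorker ≠ .idle || o.tapeWorker ≠ .idle || o.pillage

namespace World

/-- Number of turns that it takes to build `k`. -/
def turns (W : World) : Build → ℕ
  | .road => W.roadTurns
  | .terrascape => W.terrascapeTurns

/-- Culture yield of a worked Terrascape on the given terrain. -/
def terrascapeYield (W : World) (x : Terrain) : ℕ :=
  W.terrascapeCulture x + if W.ecoscaping then 1 else 0

/-- The Culture yield of the player in the turn: base yield and worked Terrascapes. -/
def culture (W : World) (s : GameState) : ℕ :=
  W.baseCulture + ∑ t ∈ W.worked,
    if s.board.improvement t = .terrascape then W.terrascapeYield (W.terrain t) else 0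

/-- The normalized Culture yield: difference from the base yield, in units of the yield of
one Terrascape on desert. -/
def normalizedCulture (W : World) (s : GameState) : ℚ :=
  ((W.culture s : ℚ) - W.baseCulture) / W.terrascapeYield .desert

/-- A unit can get from `t` to `t'` in a turn: it stays or moves to an adjacent tile. -/
def CanMove (W : World) (t t' : Tile) : Prop :=
  t' = t ∨ (Adjacent t t' ∧ t' ∈ W.traversable)

/-- A Worker on tile `t` is able to build: Roads on every tile without improvement, Terrascapes
only on the player's own tiles, with the technology, and if one more can be maintained. -/
def CanBuild (W : World) (B : Board) (t : Tile) : Build → Prop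
  | .road => B.improvement t = .none
  | .terrascape => B.improvement t = .none ∧ t ∈ W.owned ∧ W.terraforming = true ∧
      {u | B.improvement u = .terrascape}.encard < W.maintainable

end World

/-- Put an improvement on a tile, or clear it. -/
def Board.set (B : Board) (t : Tile) (i : Improvement) : Board :=
  { B with improvement := Function.update B.improvement t i }

/-- Set the progress of a building project on a tile. -/
def Board.setProgress (B : Board) (t : Tile) (k : Build) (n : ℕ) : Board :=
  { B with progress := Function.update B.progress t (Function.update (B.progress t) k n) }

/-- `Works W t j B B'`: one turn of job `j` by a Worker on tile `t` turns board `B` into `B'`.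
Building takes `W.turns k` turns, repairing and removing take one turn. -/
inductive Works (W : World) (t : Tile) : Job → Board → Board → Prop
  | idle (B : Board) : Works W t .idle B B
  | goOn (B : Board) (k : Build) :
      W.CanBuild B t k → B.progress t k + 1 < W.turns k →
      Works W t (.build k) B (B.setProgress t k (B.progress t k + 1))
  | finish (B : Board) (k : Build) :
      W.CanBuild B t k → W.turns k ≤ B.progress t k + 1 →
      Works W t (.build k) B ((B.setProgress t k 0).set t k.result)
  | repair (B : Board) :
      B.improvement t = .pillagedRoad → Works W t .repair B (B.set t .road)
  | remove (B : Board) :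
      B.improvement t ≠ .none → Works W t .remove B (B.set t .none)

/-- The Rover on tile `t` pillages the Road there, or does nothing. -/
inductive Pillages (t : Tile) : Bool → Board → Board → Prop
  | idle (B : Board) : Pillages t false B B
  | pillage (B : Board) :
      B.improvement t = .road → Pillages t true B (B.set t .pillagedRoad)

/-- One turn: all units move (the two Workers must not end on the same tile), then the Rover may
pillage, then the Workers do one turn of work. There is no other player, so nothing else
changes; and there is no limit on the number of turns. -/
def Turn (W : World) (s : GameState) (o : Orders) (s' : GameState) : Prop :=
  W.CanMove s.stateWorker s'.stateWorker ∧
  W.CanMove s.tapeWorker s'.tapeWorker ∧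
  W.CanMove s.rover s'.rover ∧
  s'.stateWorker ≠ s'.tapeWorker ∧
  ∃ B₁ B₂, Pillages s'.rover o.pillage s.board B₁ ∧
    Works W s'.tapeWorker o.tapeWorker B₁ B₂ ∧
    Works W s'.stateWorker o.stateWorker B₂ s'.board

/-- `Play W s os s'`: the orders `os`, one entry per turn, can lead from `s` to `s'`. -/
inductive Play (W : World) : GameState → List Orders → GameState → Prop
  | nil (s : GameState) : Play W s [] s
  | cons {s s₁ s' : GameState} {o : Orders} {os : List Orders} :
      Turn W s o s₁ → Play W s₁ os s' → Play W s (o :: os) s'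

/-- The standing assumptions on the session. -/
structure World.Suitable (W : World) : Prop where
  /-- the tape is a continuous strip, infinite in both directions, of flat traversable tiles -/
  strip_injective : Function.Injective W.strip
  strip_adjacent : ∀ i, Adjacent (W.strip i) (W.strip (i + 1))
  strip_traversable : ∀ i, W.strip i ∈ W.traversable
  /-- the state section is disjoint from it, connected, and consists of flat desert tiles owned
  by the player -/
  section_disjoint : ∀ i, W.strip i ∉ W.stateSection
  section_connected : ∀ s ∈ W.stateSection, ∀ t ∈ W.stateSection,
    Relation.ReflTransGen (fun u v => Adjacent u v ∧ v ∈ W.stateSection) s t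
  section_desert : ∀ t ∈ W.stateSection, W.terrain t = .desert
  section_traversable : ∀ t ∈ W.stateSection, t ∈ W.traversable
  section_owned : ∀ t ∈ W.stateSection, t ∈ W.owned
  /-- at least nine tiles of the section are worked -/
  nine_worked : 9 ≤ (W.stateSection ∩ W.worked).card
  /-- at least nine Terrascapes can be built and maintained -/
  nine_maintainable : 9 ≤ W.maintainable
  has_terraforming : W.terraforming = true
  has_ecoscaping : W.ecoscaping = true
  roadTurns_pos : 1 ≤ W.roadTurns
  terrascapeTurns_pos : 1 ≤ W.terrascapeTurns

/-- The game state `s` represents the configuration `c`: the internal state is the normalized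
Culture yield, the tape is the strip, and the tape Worker and the Rover are the head. The state
Worker is in the state section; Terrascapes stand only on its worked tiles, and
these tiles carry nothing else. -/
structure Represents (W : World) (s : GameState) (c : Cfg (Fin 10) TileSymbol) : Prop where
  state_eq : W.normalizedCulture s = (c.state.val : ℚ)
  tape_eq : ∀ i, s.board.improvement (W.strip i) = (c.tape i).improvement
  tapeWorker_eq : s.tapeWorker = W.strip c.head
  rover_eq : s.rover = W.strip c.head
  stateWorker_mem : s.stateWorker ∈ W.stateSection
  terrascape_mem : ∀ t, s.board.improvement t = .terrascape → t ∈ W.stateSection ∩ W.worked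
  stateTile : ∀ t ∈ W.stateSection ∩ W.worked,
    s.board.improvement t = .none ∨ s.board.improvement t = .terrascape

/-- The jobs that a tape command asks for, of the tape Worker and of the Rover. -/
def TapeCommand.Permits : TapeCommand → Job → Bool → Prop
  | .leave, j, p => j = .idle ∧ p = false
  | .buildRoad, j, p => (j = .idle ∨ j = .build .road) ∧ p = false
  | .buildRoadAndPillage, j, _ => j = .idle ∨ j = .build .road
  | .pillageRoad, j, _ => j = .idle
  | .repairRoad, j, p => (j = .idle ∨ j = .repair) ∧ p = false
  | .removeImprovement, j, p => (j = .idle ∨ j = .remove) ∧ p = false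

/-- The jobs that a state command asks for, of the state Worker. -/
def StateCommand.Permits : StateCommand → Job → Prop
  | .noBuild, j => j = .idle
  | .build _, j => j = .idle ∨ j = .build .terrascape
  | .remove _, j => j = .idle ∨ j = .remove

/-- In the turn, the units do nothing but what the command asks for (or only move). -/
def Command.Permits (k : Command) (o : Orders) : Prop :=
  k.tape.Permits o.tapeWorker o.pillage ∧ k.state.Permits o.stateWorker

end CivBE

/-!
Universality. The map that sends a program and an input to the halting configuration is partial
recursive, and Mathlib compiles it to a Turing machine with two symbols. Each half of the tape of
such a machine is a binary number, and so the machine becomes one that doubles and halves two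
numbers. Following Cocke and Minsky, a 2-tag system keeps these numbers as lengths of unary blocks:
deleting two letters at a time halves a block, and the phase in which the pass ends reveals its
parity. Rogozhin's machine executes 2-tag systems. The productions are written to the left of the
head as groups of blocks, and the word to the right of it as unary numbers; each Road that is read
off the first letter marks one more group, so that the machine arrives at the production of this
letter, which it then copies to the end of the word. Every encoding on the way is primitive
recursive in the program, which enters only through the content of the tape.

The game. The number of Terrascapes is the state, and the tape Worker and the Rover act as the head.
The state section is finite and connected, and so the state Worker reaches a suitable tile of it
within a number of turns that depends only on the session. A command builds at most three
Terrascapes or removes at most five, each in one turn, which leaves room for the turn in which the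
Rover pillages a new Road.
-/

namespace CivBE

open StateTransition

local notation "𝟎" => TileSymbol.noImprovement
local notation "𝟏" => TileSymbol.road
local notation "𝐛" => TileSymbol.pillagedRoad

/-! ### Configurations seen from a gap of the tape -/

section Gap

variable {Q Γ : Type}

/-- A configuration of a Turing machine seen from a gap between two cells next to the head: `l` is
the tape left of the gap, read leftwards, and `r` the tape right of it; only blanks follow. The head
is on the cell next to the gap on the side `dir`. Such a configuration has no absolute position. -/
structure Gap (Q Γ : Type) where
  dir : Dir
  state : Q
  l : List Γ
  r : List Γ

/-- One step of `M` on a tape given by two lists. -/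
def TuringMachine.gapStep (M : TuringMachine Q Γ) : Gap Q Γ → Option (Gap Q Γ)
  | ⟨.R, q, l, r⟩ => (M.δ q (r.headD M.blank)).map fun
      | (q', a, .R) => ⟨.R, q', a :: l, r.tail⟩
      | (q', a, .L) => ⟨.L, q', l, a :: r.tail⟩
  | ⟨.L, q, l, r⟩ => (M.δ q (l.headD M.blank)).map fun
      | (q', a, .R) => ⟨.R, q', a :: l.tail, r⟩
      | (q', a, .L) => ⟨.L, q', l.tail, a :: r⟩

/-- The two-way infinite tape with the gap left of cell `p`. -/
def gapTape (blank : Γ) (p : ℤ) (l r : List Γ) (i : ℤ) : Γ :=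
  if p ≤ i then r.getD (i - p).toNat blank else l.getD (p - 1 - i).toNat blank

/-- The configuration with the gap left of cell `p`. -/
def Gap.toCfg (blank : Γ) (p : ℤ) (g : Gap Q Γ) : Cfg Q Γ where
  state := g.state
  head := match g.dir with
    | .R => p
    | .L => p - 1
  tape := gapTape blank p g.l g.r

variable (blank : Γ) (p : ℤ) (l r : List Γ) (a : Γ)

theorem gapTape_add_natCast (n : ℕ) : gapTape blank p l r (p + n) = r.getD n blank := by
  simp [gapTape]

theorem gapTape_pred_sub_natCast (n : ℕ) :
    gapTape blank p l r (p - 1 - n) = l.getD n blank := by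
  simp [gapTape, show ¬ p ≤ p - 1 - n by lia]

theorem gapTape_self : gapTape blank p l r p = r.headD blank := by
  cases r <;> simp [gapTape]

theorem gapTape_pred : gapTape blank p l r (p - 1) = l.headD blank := by
  cases l <;> simp [gapTape]

variable {blank p l r} in
theorem eq_gapTape {t : ℤ → Γ} (hr : ∀ n : ℕ, t (p + n) = r.getD n blank)
    (hl : ∀ n : ℕ, t (p - 1 - n) = l.getD n blank) : t = gapTape blank p l r := by
  ext i
  rcases le_or_gt p i with h | h
  · obtain ⟨n, rfl⟩ := Int.le.dest h
    rw [hr, gapTape_add_natCast]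
  · obtain ⟨n, rfl⟩ : ∃ n : ℕ, i = p - 1 - n := ⟨(p - 1 - i).toNat, by lia⟩
    rw [hl, gapTape_pred_sub_natCast]

theorem gapTape_shift : gapTape blank p l (a :: r) = gapTape blank (p + 1) (a :: l) r := by
  refine eq_gapTape (fun n => ?_) fun n => ?_
  · rw [add_assoc, ← Nat.cast_one, ← Nat.cast_add, gapTape_add_natCast, add_comm]
    rfl
  · cases n with
    | zero => simp [gapTape_self]
    | succ n =>
      rw [show p + 1 - 1 - ((n + 1 : ℕ) : ℤ) = p - 1 - n by push_cast; ring,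
        gapTape_pred_sub_natCast]
      rfl

theorem update_gapTape_self :
    Function.update (gapTape blank p l r) p a = gapTape blank p l (a :: r.tail) := by
  refine eq_gapTape (fun n => ?_) fun n => ?_
  · cases n with
    | zero => simp
    | succ n =>
      rw [Function.update_of_ne (by lia), gapTape_add_natCast]
      cases r <;> rfl
  · rw [Function.update_of_ne (by lia), gapTape_pred_sub_natCast]

theorem update_gapTape_pred :
    Function.update (gapTape blank p l r) (p - 1) a = gapTape blank p (a :: l.tail) r := by
  refine eq_gapTape (fun n => ?_) fun n => ?_
  · rw [Function.update_of_ne (by lia), gapTape_add_natCast]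
  · cases n with
    | zero => simp
    | succ n =>
      rw [Function.update_of_ne (by lia), gapTape_pred_sub_natCast]
      cases l <;> rfl

namespace TuringMachine

variable (M : TuringMachine Q Γ)

theorem step_toCfg (g : Gap Q Γ) :
    ∃ f : Gap Q Γ → ℤ, M.step (g.toCfg M.blank p) =
      (M.gapStep g).map fun g' => g'.toCfg M.blank (f g') := by
  obtain ⟨d, q, l, r⟩ := g
  refine ⟨fun g' => match d, g'.dir with
    | .R, .R => p + 1
    | .L, .L => p - 1
    | _, _ => p, ?_⟩
  cases d
  · simp only [step, Gap.toCfg, gapStep, gapTape_pred, update_gapTape_pred]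
    rcases M.δ q (l.headD M.blank) with _ | ⟨q', a, _ | _⟩ <;>
      simp [Dir.shift, gapTape_shift]
  · simp only [step, Gap.toCfg, gapStep, gapTape_self, update_gapTape_self]
    rcases M.δ q (r.headD M.blank) with _ | ⟨q', a, _ | _⟩ <;>
      simp [Dir.shift, gapTape_shift]

theorem gapStep_respects :
    Respects M.gapStep M.step fun g c => ∃ p, c = g.toCfg M.blank p := by
  rintro g _ ⟨p, rfl⟩
  obtain ⟨f, hf⟩ := M.step_toCfg p g
  cases h : M.gapStep g with
  | none => simpa [h] using hf
  | some g' => exact ⟨_, ⟨f g', rfl⟩, .single (by simpa [h] using hf)⟩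

theorem init_eq_toCfg : M.init (l, r) = (Gap.mk .R M.start l r).toCfg M.blank 0 := by
  have : (M.init (l, r)).tape = gapTape M.blank 0 l r := by
    ext i
    simp only [init, gapTape, sub_zero, show 0 - 1 - i = -i - 1 by ring]
  rw [Gap.toCfg, ← this]
  rfl

end TuringMachine

end Gap

/-! ### Sweeps of the machine of the command table -/

section Rogozhin

local infix:50 " ⟶* " => Reaches (TuringMachine.gapStep civMachine)

/-- The effect of a leftward sweep in state `1`: Roads are removed. -/
def clear : TileSymbol → TileSymbol
  | 𝟏 => 𝟎
  | a => a

/-- The effect of a rightward sweep in state `0`: Roads are built. -/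
def fill : TileSymbol → TileSymbol
  | 𝟎 => 𝟏
  | a => a

theorem map_clear_map_fill {m : List TileSymbol} (h : 𝟏 ∉ m) : (m.map fill).map clear = m := by
  rw [List.map_map, List.map_congr_left (g := id), List.map_id]
  rintro (_ | _ | _) ha
  exacts [rfl, absurd ha h, rfl]

theorem replicate_append_cons {α : Type*} (n : ℕ) (a : α) (l : List α) :
    List.replicate n a ++ a :: l = List.replicate (n + 1) a ++ l := by
  rw [List.replicate_succ', List.append_assoc, List.singleton_append]

/-- Parts of the tape, read leftwards, that the head can pass while it looks for productions: each
pillaged Road is preceded by a Road, and there are no empty tiles. -/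
inductive Passable : List TileSymbol → Prop
  | nil : Passable []
  | road {m : List TileSymbol} : Passable m → Passable (𝟏 :: m)
  | pillaged {m : List TileSymbol} : Passable m → Passable (𝟏 :: 𝐛 :: m)

namespace Passable

variable {m m' : List TileSymbol}

theorem append (h : Passable m) (h' : Passable m') : Passable (m ++ m') := by
  induction h with
  | nil => exact h'
  | road _ ih => exact .road ih
  | pillaged _ ih => exact .pillaged ih

theorem replicate (n : ℕ) : Passable (List.replicate n 𝟏) := by
  induction n with
  | zero => exact .nil
  | succ n ih => exact .road ih

theorem replicate_append_pillaged (n : ℕ) : Passable (List.replicate (n + 1) 𝟏 ++ [𝐛]) := by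
  rw [List.replicate_succ', List.append_assoc]
  exact (replicate n).append (.pillaged .nil)

theorem flatten {ms : List (List TileSymbol)} (h : ∀ m ∈ ms, Passable m) :
    Passable ms.flatten := by
  induction ms with
  | nil => exact .nil
  | cons m ms ih =>
    rw [List.forall_mem_cons] at h
    exact h.1.append (ih h.2)

theorem zero_notMem (h : Passable m) : 𝟎 ∉ m := by
  induction h with
  | nil => simp
  | road _ ih => simpa using ih
  | pillaged _ ih => simpa using ih

theorem sweep_one_left (h : Passable m) (l r : List TileSymbol) :
    ⟨.L, 1, m ++ l, r⟩ ⟶* ⟨.L, 1, l, (m.map clear).reverse ++ r⟩ := by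
  induction h generalizing r with
  | nil => exact .refl
  | road _ ih => exact .head rfl (by simpa using! ih (𝟎 :: r))
  | pillaged _ ih => exact .head rfl (.head rfl (by simpa using! ih (𝐛 :: 𝟎 :: r)))

theorem sweep_zero_right (h : Passable m) (l r : List TileSymbol) :
    ⟨.R, 0, l, (m.map clear).reverse ++ r⟩ ⟶* ⟨.R, 0, m ++ l, r⟩ := by
  induction h generalizing r with
  | nil => exact .refl
  | road _ ih => simpa using! (ih (𝟎 :: r)).tail rfl
  | pillaged _ ih => simpa using! ((ih (𝐛 :: 𝟎 :: r)).tail rfl).tail rfl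

theorem sweep_nine_right (h : Passable m) (l r : List TileSymbol) :
    ⟨.R, 9, l, m.reverse ++ r⟩ ⟶* ⟨.R, 9, m.map clear ++ l, r⟩ := by
  induction h generalizing r with
  | nil => exact .refl
  | road _ ih => simpa using! (ih (𝟏 :: r)).tail rfl
  | pillaged _ ih => simpa using! ((ih (𝐛 :: 𝟏 :: r)).tail rfl).tail rfl

end Passable

theorem sweep_five_left {x : List TileSymbol} (h : 𝟎 ∉ x) (l r : List TileSymbol) :
    ⟨.L, 5, x.reverse ++ l, r⟩ ⟶* ⟨.L, 5, l, x ++ r⟩ := by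
  induction x using List.reverseRecOn generalizing r with
  | nil => exact .refl
  | append_singleton x a ih =>
    rw [List.mem_append, not_or] at h
    rw [List.reverse_concat]
    cases a
    · simp at h
    · exact .head rfl (by simpa using! ih h.1 (𝟏 :: r))
    · exact .head rfl (by simpa using! ih h.1 (𝐛 :: r))

theorem sweep_four_right {x : List TileSymbol} (h : 𝟎 ∉ x) (l r : List TileSymbol) :
    ⟨.R, 4, l, x ++ r⟩ ⟶* ⟨.R, 4, x.reverse ++ l, r⟩ := by
  induction x generalizing l with
  | nil => exact .refl
  | cons a x ih =>
    rw [List.mem_cons, not_or] at h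
    cases a
    · exact absurd rfl h.1
    · exact .head rfl (by simpa using! ih h.2 (𝟏 :: l))
    · exact .head rfl (by simpa using! ih h.2 (𝐛 :: l))

theorem sweep_seven_right {x : List TileSymbol} (h : 𝟎 ∉ x) (l r : List TileSymbol) :
    ⟨.R, 7, l, x ++ r⟩ ⟶* ⟨.R, 7, x.reverse ++ l, r⟩ := by
  induction x generalizing l with
  | nil => exact .refl
  | cons a x ih =>
    rw [List.mem_cons, not_or] at h
    cases a
    · exact absurd rfl h.1
    · exact .head rfl (by simpa using! ih h.2 (𝟏 :: l))
    · exact .head rfl (by simpa using! ih h.2 (𝐛 :: l))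

theorem sweep_zero_right_replicate (n : ℕ) (l r : List TileSymbol) :
    ⟨.R, 0, l, List.replicate n 𝟎 ++ r⟩ ⟶* ⟨.R, 0, List.replicate n 𝟏 ++ l, r⟩ := by
  induction n generalizing l with
  | zero => exact .refl
  | succ n ih => exact .head rfl (by simpa [replicate_append_cons] using! ih (𝟏 :: l))

theorem sweep_one_left_replicate (n : ℕ) (l r : List TileSymbol) :
    ⟨.L, 1, List.replicate (2 * n) 𝟎 ++ l, r⟩ ⟶*
      ⟨.L, 1, l, List.replicate (2 * n) 𝟎 ++ r⟩ := by
  induction n generalizing r with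
  | zero => exact .refl
  | succ n ih =>
    exact .head rfl (.head rfl (by simpa [replicate_append_cons] using! ih (𝟎 :: 𝟎 :: r)))

/-- A part of the tape, read leftwards, that is converted when one Road of the data is read: blocks
of empty tiles of even length and a last one of odd length, each ended by a pillaged Road. The
machine turns back at the block of odd length. -/
inductive Chunk : List TileSymbol → Prop
  | last (n : ℕ) : Chunk (List.replicate (2 * n + 1) 𝟎 ++ [𝐛])
  | cons (n : ℕ) {c : List TileSymbol} :
      Chunk c → Chunk (List.replicate (2 * n + 2) 𝟎 ++ 𝐛 :: c)

namespace Chunk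

variable {c m : List TileSymbol}

theorem passable (h : Chunk c) : Passable (c.map fill) := by
  induction h with
  | last n => simpa [fill] using! Passable.replicate_append_pillaged (2 * n)
  | cons n _ ih =>
    simpa [fill] using! (Passable.replicate_append_pillaged (2 * n + 1)).append ih

theorem road_notMem (h : Chunk c) : 𝟏 ∉ c := by
  induction h with
  | last n => simp
  | cons n _ ih => simpa using ih

theorem search (h : Chunk c) (l r : List TileSymbol) :
    ⟨.L, 1, c ++ l, r⟩ ⟶* ⟨.R, 0, c.map fill ++ l, r⟩ := by
  induction h generalizing r with
  | last n =>
    have left := sweep_one_left_replicate n (𝟎 :: 𝐛 :: l) r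
    have right := sweep_zero_right_replicate (2 * n + 1) (𝐛 :: l) r
    rw [replicate_append_cons] at left
    simpa [fill] using! left.trans (.head rfl (.head rfl right))
  | @cons n c _ ih =>
    have left := sweep_one_left_replicate (n + 1) (𝐛 :: c ++ l) r
    have rest := ih (𝐛 :: 𝟎 :: List.replicate (2 * n + 1) 𝟎 ++ r)
    have right := sweep_zero_right_replicate (2 * n + 1) (𝟏 :: 𝐛 :: c.map fill ++ l) r
    rw [List.cons_append, List.cons_append, replicate_append_cons] at right
    simpa [fill] using! left.trans (.head rfl (rest.trans (.head rfl (.head rfl right))))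

theorem read_road (hm : Passable m) (hc : Chunk c) (l r : List TileSymbol) :
    ⟨.R, 0, m ++ (c ++ l), 𝟏 :: r⟩ ⟶* ⟨.R, 0, 𝟏 :: m ++ (c.map fill ++ l), r⟩ :=
  .head rfl <| (hm.sweep_one_left _ _).trans <| (hc.search _ _).trans <|
    (hm.sweep_zero_right _ _).tail rfl

end Chunk

theorem read_roads {cs : List (List TileSymbol)} (hcs : ∀ c ∈ cs, Chunk c)
    {m : List TileSymbol} (hm : Passable m) (l r : List TileSymbol) :
    ⟨.R, 0, m ++ (cs.flatten ++ l), List.replicate cs.length 𝟏 ++ r⟩ ⟶*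
      ⟨.R, 0, List.replicate cs.length 𝟏 ++ (m ++ (cs.flatten.map fill ++ l)), r⟩ := by
  induction cs generalizing m with
  | nil => exact .refl
  | cons c cs ih =>
    rw [List.forall_mem_cons] at hcs
    have first :=
      Chunk.read_road hm hcs.1 (cs.flatten ++ l) (List.replicate cs.length 𝟏 ++ r)
    have rest := ih hcs.2 (.append (.road hm) hcs.1.passable)
    simpa [replicate_append_cons] using! first.trans (by simpa [replicate_append_cons] using! rest)

theorem write_roads (n : ℕ) (l : List TileSymbol) {x : List TileSymbol} (hx : 𝟎 ∉ x) :
    ⟨.L, 5, List.replicate (n + 1) 𝟎 ++ l, x⟩ ⟶*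
      ⟨.L, 5, 𝟎 :: l, List.replicate n 𝟏 ++ x ++ List.replicate n 𝟏⟩ := by
  induction n generalizing x with
  | zero => simpa using! Relation.ReflTransGen.refl
  | succ n ih =>
    have right := sweep_seven_right (x := 𝟏 :: x) (by simpa) (List.replicate (n + 1) 𝟎 ++ l) []
    have left := sweep_five_left (x := 𝟏 :: x) (by simpa) (List.replicate (n + 1) 𝟎 ++ l) [𝟏]
    have rest := ih (x := 𝟏 :: x ++ [𝟏]) (by simpa)
    simp only [List.append_nil, List.append_assoc,
      replicate_append_cons, List.cons_append] at right left rest ⊢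
    exact .head rfl (.head rfl (right.trans (.head rfl (left.trans rest))))

theorem write_block (n : ℕ) (l : List TileSymbol) {x : List TileSymbol} (hx : 𝟎 ∉ x) :
    ⟨.L, 5, List.replicate (n + 1) 𝟎 ++ 𝐛 :: l, x⟩ ⟶*
      ⟨.L, 8, l, 𝐛 :: List.replicate (n + 1) 𝟏 ++ x ++ List.replicate n 𝟏⟩ :=
  ((write_roads n (𝐛 :: l) hx).tail rfl).tail rfl

theorem write_separator (l : List TileSymbol) {x : List TileSymbol} (hx : 𝟎 ∉ x) :
    ⟨.R, 4, l, x ++ [𝟏]⟩ ⟶* ⟨.L, 5, l, x ++ [𝐛, 𝐛]⟩ := by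
  have right := sweep_four_right (x := x ++ [𝟏]) (by simpa) l []
  have left := sweep_five_left hx l [𝐛, 𝐛]
  rw [List.append_nil, List.reverse_append] at right
  exact right.trans (.head rfl (.head rfl left))

theorem write_letter (n : ℕ) (l : List TileSymbol) {x : List TileSymbol} (hx : 𝟎 ∉ x) :
    ⟨.L, 8, List.replicate (n + 2) 𝟎 ++ 𝐛 :: l, x ++ [𝟏]⟩ ⟶*
      ⟨.L, 8, l, 𝐛 :: List.replicate (n + 2) 𝟏 ++ x ++ [𝐛, 𝐛] ++ List.replicate n 𝟏⟩ := by
  have separator := write_separator (x := 𝟏 :: x) (List.replicate (n + 1) 𝟎 ++ 𝐛 :: l) (by simpa)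
  have block := write_block n l (x := 𝟏 :: x ++ [𝐛, 𝐛]) (by simpa)
  simp only [List.cons_append, List.append_assoc, replicate_append_cons] at block ⊢
  exact .head rfl (.head rfl (separator.trans block))

/-! ### Execution of tag systems -/

/-- The code of a word whose letters are natural numbers: the letter `k` is a block of `2 * k + 1`
Roads, and each letter is followed by a separator, two pillaged Roads. -/
def wordCode (w : List ℕ) : List TileSymbol :=
  w.flatMap fun k => List.replicate (2 * k + 1) 𝟏 ++ [𝐛, 𝐛]

/-- `wordCode` without the last separator. -/
def wordCore (w : List ℕ) : List TileSymbol :=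
  [𝐛, 𝐛].intercalate (w.map fun k => List.replicate (2 * k + 1) 𝟏)

theorem wordCode_cons (k : ℕ) (w : List ℕ) :
    wordCode (k :: w) = List.replicate (2 * k + 1) 𝟏 ++ 𝐛 :: 𝐛 :: wordCode w := by
  simp [wordCode]

theorem wordCode_append (v w : List ℕ) : wordCode (v ++ w) = wordCode v ++ wordCode w :=
  List.flatMap_append

theorem zero_notMem_wordCode (w : List ℕ) : 𝟎 ∉ wordCode w := by
  simp [wordCode]

theorem wordCode_eq {w : List ℕ} (hw : w ≠ []) : wordCode w = wordCore w ++ [𝐛, 𝐛] := by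
  induction w with
  | nil => exact absurd rfl hw
  | cons k w ih =>
    cases w with
    | nil => simp [wordCode, wordCore]
    | cons k' w => rw [wordCode_cons, ih (by simp)]; simp [wordCore]

theorem zero_notMem_wordCore (w : List ℕ) : 𝟎 ∉ wordCore w := by
  rcases eq_or_ne w [] with rfl | hw
  · simp [wordCore]
  · have := zero_notMem_wordCode w
    rw [wordCode_eq hw, List.mem_append, not_or] at this
    exact this.1

theorem wordCore_cons (k : ℕ) {w : List ℕ} (hw : w ≠ []) :
    wordCore (k :: w) = List.replicate (2 * k + 1) 𝟏 ++ 𝐛 :: 𝐛 :: wordCore w := by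
  obtain ⟨k', w, rfl⟩ := List.exists_cons_of_ne_nil hw
  simp [wordCore]

theorem wordCore_concat (w : List ℕ) (k : ℕ) :
    wordCore (w ++ [k]) = wordCode w ++ List.replicate (2 * k + 1) 𝟏 := by
  refine List.append_cancel_right (bs := [𝐛, 𝐛]) ?_
  rw [← wordCode_eq (by simp), wordCode_append, List.append_assoc]
  simp [wordCode]

theorem wordCode_append_replicate (w : List ℕ) (k : ℕ) :
    wordCode w ++ List.replicate (2 * k + 2) 𝟏 = wordCore (w ++ [k]) ++ [𝟏] := by
  rw [wordCore_concat, List.append_assoc, ← List.replicate_succ']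

/-- The code of the letters of a production after the first one, read leftwards. -/
def prodTail (v : List ℕ) : List TileSymbol :=
  v.flatMap fun k => List.replicate (2 * k + 4) 𝟎 ++ [𝐛]

theorem chunk_prodTail (v : List ℕ) : Chunk (prodTail v ++ [𝟎, 𝐛]) := by
  induction v with
  | nil => exact .last 0
  | cons k v ih => simpa [prodTail, mul_add] using Chunk.cons (k + 1) ih

theorem passable_prodTail (v : List ℕ) : Passable ((prodTail v).map fill) := by
  rw [prodTail, List.map_flatMap]
  refine Passable.flatten fun m hm => ?_
  obtain ⟨k, -, rfl⟩ := List.mem_map.mp hm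
  simpa [fill] using Passable.replicate_append_pillaged (2 * k + 3)

theorem write_prodTail (v : List ℕ) {u : List ℕ} (hu : u ≠ []) (l : List TileSymbol)
    {y : List TileSymbol} (hy : 𝟎 ∉ y) :
    ⟨.L, 8, prodTail v ++ l, y ++ (wordCore u ++ [𝟏])⟩ ⟶*
      ⟨.L, 8, l, ((prodTail v).map fill).reverse ++ y ++ (wordCore (u ++ v) ++ [𝟏])⟩ := by
  induction v generalizing u y with
  | nil => simpa [prodTail] using! Relation.ReflTransGen.refl
  | cons k v ih =>
    have letter := write_letter (2 * k + 2) (prodTail v ++ l) (x := y ++ wordCore u)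
      (by simpa [zero_notMem_wordCore] using hy)
    have rest := ih (u := u ++ [k]) (by simp) (y := 𝐛 :: List.replicate (2 * k + 4) 𝟏 ++ y)
      (by simpa using hy)
    rw [← wordCode_append_replicate, wordCode_eq hu] at rest
    simp only [List.append_assoc, List.cons_append] at letter rest
    simpa [prodTail, fill] using! letter.trans rest

/-- The code of all the letters of a nonempty production, read leftwards; the first letter is one
tile shorter, so that the machine turns back there. -/
def prodBlocks (c : ℕ) (v : List ℕ) : List TileSymbol :=
  List.replicate (2 * c + 3) 𝟎 ++ 𝐛 :: prodTail v

theorem passable_prodBlocks (c : ℕ) (v : List ℕ) : Passable ((prodBlocks c v).map fill) := by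
  simpa [prodBlocks, fill] using
    (Passable.replicate_append_pillaged (2 * c + 2)).append (passable_prodTail v)

theorem road_notMem_prodBlocks (c : ℕ) (v : List ℕ) : 𝟏 ∉ prodBlocks c v := by
  simp [prodBlocks, prodTail]

/-- The code of a production together with an end mark, as two chunks. -/
def prodChunks : List ℕ → List (List TileSymbol)
  | [] => []
  | c :: v => [List.replicate (2 * c + 3) 𝟎 ++ [𝐛], prodTail v ++ [𝟎, 𝐛]]

/-- The tape left of the head, read leftwards: `2 * n + 1` empty tiles where letters have been
erased, an empty chunk, and the codes of the productions `P`. -/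
def chunks (n : ℕ) (P : List (List ℕ)) : List (List TileSymbol) :=
  (List.replicate (2 * n + 1) 𝟎 ++ [𝐛]) :: [𝟎, 𝐛] :: P.flatMap prodChunks

theorem chunk_of_mem_chunks {n : ℕ} {P : List (List ℕ)} : ∀ c ∈ chunks n P, Chunk c := by
  simp only [chunks, List.forall_mem_cons, List.mem_flatMap]
  refine ⟨.last n, .last 0, ?_⟩
  rintro c ⟨_ | ⟨k, v⟩, -, h⟩
  · simp [prodChunks] at h
  · rcases List.mem_pair.mp h with rfl | rfl
    exacts [.last (k + 1), chunk_prodTail v]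

theorem length_chunks (n : ℕ) {P : List (List ℕ)} (hP : [] ∉ P) :
    (chunks n P).length = 2 * P.length + 2 := by
  have : ∀ p ∈ P, (prodChunks p).length = 2 := by
    rintro (_ | _) hp
    exacts [absurd hp hP, rfl]
  simp [chunks, List.length_flatMap, List.map_congr_left this, mul_comm]

/-- The tape with a word of the tag system whose letter `k` has the `k`-th production of `P`; the
letter `P.length` is the halting one. -/
def tagGap (P : List (List ℕ)) (n : ℕ) (w : List ℕ) : Gap (Fin 10) TileSymbol where
  dir := .R
  state := 0
  l := 𝟏 :: ((chunks n P).flatten ++ [𝟎, 𝟏])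
  r := 𝟏 :: 𝟎 :: (wordCore w ++ [𝟏])

/-- The part of the tape, read leftwards, that the head has passed when the letter `a` and the
chunks `cs` have been read. -/
def passed (a : ℕ) (cs : List (List TileSymbol)) : List TileSymbol :=
  List.replicate (2 * a + 4) 𝟏 ++ cs.flatten.map fill

theorem passable_flatten {cs : List (List TileSymbol)} (hcs : ∀ c ∈ cs, Chunk c) :
    Passable (cs.flatten.map fill) := by
  rw [List.map_flatten]
  refine .flatten fun m hm => ?_
  obtain ⟨c, hc, rfl⟩ := List.mem_map.mp hm
  exact (hcs c hc).passable

theorem passable_passed (a : ℕ) {cs : List (List TileSymbol)} (hcs : ∀ c ∈ cs, Chunk c) :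
    Passable (passed a cs) :=
  (Passable.replicate _).append (passable_flatten hcs)

theorem read_letter (a : ℕ) {cs : List (List TileSymbol)} (hcs : ∀ c ∈ cs, Chunk c)
    (hlen : cs.length = 2 * a + 2) (l r : List TileSymbol) :
    ⟨.R, 0, 𝟏 :: (cs.flatten ++ l), 𝟏 :: 𝟎 :: (List.replicate (2 * a + 1) 𝟏 ++ r)⟩ ⟶*
      ⟨.R, 0, passed a cs ++ l, r⟩ := by
  obtain _ | ⟨c, cs⟩ := cs
  · simp at hlen
  rw [List.forall_mem_cons] at hcs
  have first := Chunk.read_road (m := [𝟏]) (.road .nil) hcs.1 (cs.flatten ++ l)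
    (𝟎 :: (List.replicate (2 * a + 1) 𝟏 ++ r))
  have rest := read_roads hcs.2 (m := 𝟏 :: 𝟏 :: 𝟏 :: c.map fill)
    (.road (.road (.road hcs.1.passable))) l r
  rw [show cs.length = 2 * a + 1 by simpa using hlen] at rest
  simpa [passed, replicate_append_cons] using!
    first.trans (.head rfl (by simpa [replicate_append_cons] using! rest))

theorem find_production (a : ℕ) {w : List ℕ} (hw : w ≠ []) {cs : List (List TileSymbol)}
    (hcs : ∀ c ∈ cs, Chunk c) (hlen : cs.length = 2 * a + 2) (l : List TileSymbol) :
    ⟨.R, 0, 𝟏 :: (cs.flatten ++ l), 𝟏 :: 𝟎 :: (wordCore (a :: w) ++ [𝟏])⟩ ⟶*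
      ⟨.L, 5, l, (passed a cs).reverse ++ 𝟏 :: 𝟏 :: wordCode w⟩ := by
  have hp := passable_passed a hcs
  have read := read_letter a hcs hlen l (𝐛 :: 𝐛 :: (wordCore w ++ [𝟏]))
  have turn : ⟨.R, 0, passed a cs ++ l, 𝐛 :: 𝐛 :: (wordCore w ++ [𝟏])⟩ ⟶*
      ⟨.R, 4, passed a cs ++ l, (𝟏 :: 𝟏 :: wordCore w) ++ [𝟏]⟩ :=
    .head rfl (.head rfl (.head rfl (.head rfl .refl)))
  have separator := write_separator (passed a cs ++ l) (x := 𝟏 :: 𝟏 :: wordCore w)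
    (by simpa using zero_notMem_wordCore w)
  have back := sweep_five_left (x := (passed a cs).reverse) (by simpa using hp.zero_notMem) l
    (𝟏 :: 𝟏 :: wordCode w)
  rw [List.reverse_reverse] at back
  rw [wordCore_cons a hw]
  simp only [wordCode_eq hw, List.append_assoc, List.cons_append] at back separator turn ⊢
  exact read.trans (turn.trans (separator.trans back))

theorem append_production (c : ℕ) (v u : List ℕ) (l : List TileSymbol) {y : List TileSymbol}
    (hy : 𝟎 ∉ y) :
    ⟨.L, 5, prodBlocks c v ++ l, y ++ wordCode u⟩ ⟶*
      ⟨.L, 8, l, ((prodBlocks c v).map fill).reverse ++ y ++ (wordCore (u ++ c :: v) ++ [𝟏])⟩ := by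
  have block := write_block (2 * c + 2) (prodTail v ++ l) (x := y ++ wordCode u)
    (by simpa [zero_notMem_wordCode] using hy)
  have tail := write_prodTail v (u := u ++ [c]) (by simp) l
    (y := 𝐛 :: List.replicate (2 * c + 3) 𝟏 ++ y) (by simpa using hy)
  simp only [List.append_assoc, wordCode_append_replicate, List.cons_append] at block tail
  simpa [prodBlocks, fill] using! block.trans tail

theorem restore_tape {m : List TileSymbol} (hm : Passable (𝟏 :: m)) (l r : List TileSymbol) :
    ⟨.L, 8, 𝟎 :: 𝐛 :: l, (𝟏 :: m).reverse ++ 𝐛 :: 𝐛 :: r⟩ ⟶*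
      ⟨.R, 0, 𝟏 :: (m.map clear ++ 𝟎 :: 𝐛 :: l), 𝟏 :: 𝟎 :: r⟩ := by
  have sweep := hm.sweep_nine_right (𝟎 :: 𝐛 :: l) (𝐛 :: 𝐛 :: r)
  have turn : ⟨.R, 9, (𝟏 :: m).map clear ++ 𝟎 :: 𝐛 :: l, 𝐛 :: 𝐛 :: r⟩ ⟶*
      ⟨.R, 0, 𝟏 :: (m.map clear ++ 𝟎 :: 𝐛 :: l), 𝟏 :: 𝟎 :: r⟩ :=
    .head rfl (.head rfl (.head rfl (.head rfl .refl)))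
  exact .head rfl (.head rfl (.head rfl (sweep.trans turn)))

theorem map_clear_passed (a b : ℕ) {cs : List (List TileSymbol)} (hcs : ∀ c ∈ cs, Chunk c)
    {t : List TileSymbol} (ht : 𝟏 ∉ t) :
    (List.replicate (2 * b + 2) 𝟏 ++ (passed a cs ++ t.map fill)).map clear =
      List.replicate (2 * (a + b + 3)) 𝟎 ++ (cs.flatten ++ t) := by
  have hflatten : 𝟏 ∉ cs.flatten := by simpa using fun c hc => (hcs c hc).road_notMem
  rw [show 2 * (a + b + 3) = 2 * b + 2 + (2 * a + 4) by ring, List.replicate_add _ (2 * a + 4)]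
  simp only [passed, List.map_append, map_clear_map_fill hflatten, map_clear_map_fill ht,
    List.map_replicate, clear, List.append_assoc]

theorem chunks_add_flatten (n k : ℕ) (P : List (List ℕ)) :
    (chunks (n + k) P).flatten = List.replicate (2 * k) 𝟎 ++ (chunks n P).flatten := by
  simp only [chunks, List.flatten_cons, ← List.append_assoc, ← List.replicate_add]
  congr 4
  ring

theorem chunks_flatten_split (n c : ℕ) (v : List ℕ) (P₁ P₂ : List (List ℕ)) :
    (chunks n (P₁ ++ (c :: v) :: P₂)).flatten =
      (chunks n P₁).flatten ++ (prodBlocks c v ++ 𝟎 :: 𝐛 :: (P₂.flatMap prodChunks).flatten) := by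
  simp [chunks, prodChunks, prodBlocks]

theorem tagGap_step {P₁ P₂ : List (List ℕ)} (hP : [] ∉ P₁) (n b c : ℕ) (v w : List ℕ) :
    ∃ n' > n, tagGap (P₁ ++ (c :: v) :: P₂) n (P₁.length :: b :: w) ⟶*
      tagGap (P₁ ++ (c :: v) :: P₂) n' (w ++ c :: v) := by
  set a := P₁.length
  set l := (P₂.flatMap prodChunks).flatten ++ [𝟎, 𝟏] with hl
  have hcs := chunk_of_mem_chunks (n := n) (P := P₁)
  have hpassed := passable_passed a hcs
  have find := find_production a (List.cons_ne_nil b w) hcs (length_chunks n hP)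
    (prodBlocks c v ++ 𝟎 :: 𝐛 :: l)
  have append := append_production c v (b :: w) (𝟎 :: 𝐛 :: l)
    (y := (passed a (chunks n P₁)).reverse ++ [𝟏, 𝟏]) (by simpa using hpassed.zero_notMem)
  have restore := restore_tape (.road ((Passable.replicate (2 * b + 2)).append
    (hpassed.append (passable_prodBlocks c v)))) l (wordCore (w ++ c :: v) ++ [𝟏])
  rw [List.cons_append, wordCore_cons b (by simp)] at append
  rw [map_clear_passed a b hcs (road_notMem_prodBlocks c v)] at restore
  refine ⟨n + (a + b + 3), by lia, ?_⟩
  simp only [tagGap, chunks_flatten_split, chunks_add_flatten]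
  simp only [hl, List.append_assoc, List.cons_append, List.nil_append, List.reverse_cons,
    List.reverse_append, List.reverse_replicate, replicate_append_cons, List.append_nil]
    at find append restore ⊢
  exact find.trans (append.trans restore)

theorem tagGap_halt {P : List (List ℕ)} (hP : [] ∉ P) (n b : ℕ) (w : List ℕ) :
    ∃ x, Passable x ∧ tagGap P n (P.length :: b :: w) ⟶*
      ⟨.L, 6, [𝟏], x.reverse ++ wordCode (b :: w)⟩ := by
  have hcs := chunk_of_mem_chunks (n := n) (P := P)
  have find := find_production P.length (List.cons_ne_nil b w) hcs (length_chunks n hP) [𝟎, 𝟏]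
  exact ⟨𝟏 :: 𝟏 :: passed P.length (chunks n P) ++ [𝟏],
    .append (.road (.road (passable_passed _ hcs))) (.road .nil),
    by simpa using! find.tail rfl⟩

end Rogozhin

/-- Count the occurrences of two adjacent pillaged Roads; `s` holds the previous symbol and the
number of occurrences so far. -/
def countStep (s : TileSymbol × ℕ) (a : TileSymbol) : TileSymbol × ℕ :=
  (a, if s.1 = 𝐛 ∧ a = 𝐛 then s.2 + 1 else s.2)

/-- The number of separators on a part of the tape. -/
def sepCount (x : List TileSymbol) : ℕ :=
  (x.foldl countStep (𝟎, 0)).2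

theorem Passable.foldl_countStep {m : List TileSymbol} (h : Passable m) {c : TileSymbol}
    (hc : c ≠ 𝐛) (k : ℕ) : ∃ c' ≠ 𝐛, m.reverse.foldl countStep (c, k) = (c', k) := by
  induction h with
  | nil => exact ⟨c, hc, rfl⟩
  | road _ ih =>
    obtain ⟨c', -, h⟩ := ih
    exact ⟨𝟏, by simp, by simp [-List.foldl_reverse, List.foldl_append, h, countStep]⟩
  | pillaged _ ih =>
    obtain ⟨c', hc', h⟩ := ih
    exact ⟨𝟏, by simp, by simp [-List.foldl_reverse, List.foldl_append, h, countStep, hc']⟩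

theorem foldl_countStep_replicate (n : ℕ) (s : TileSymbol × ℕ) :
    (List.replicate (n + 1) 𝟏).foldl countStep s = (𝟏, s.2) := by
  induction n generalizing s with
  | zero => simp [countStep]
  | succ n ih => rw [List.replicate_succ, List.foldl_cons, ih]; simp [countStep]

theorem foldl_countStep_wordCode (w : List ℕ) (s : TileSymbol × ℕ) :
    ((wordCode w).foldl countStep s).2 = s.2 + w.length := by
  induction w generalizing s with
  | nil => rfl
  | cons k w ih =>
    rw [wordCode_cons, List.foldl_append, foldl_countStep_replicate, List.foldl_cons,
      List.foldl_cons, ih]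
    simp only [countStep, reduceCtorEq, false_and, if_false, and_self, if_true, List.length_cons]
    lia

theorem Passable.sepCount_reverse_append_wordCode {m : List TileSymbol} (h : Passable m)
    (w : List ℕ) : sepCount (𝟏 :: (m.reverse ++ wordCode w)) = w.length := by
  obtain ⟨c, -, hc⟩ := h.foldl_countStep (c := 𝟏) (by simp) 0
  have first : countStep (𝟎, 0) 𝟏 = (𝟏, 0) := rfl
  rw [sepCount, List.foldl_cons, first, List.foldl_append, hc, foldl_countStep_wordCode, zero_add]

theorem sepCount_append_replicate (x : List TileSymbol) (n : ℕ) :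
    sepCount (x ++ List.replicate n 𝟎) = sepCount x := by
  induction n with
  | zero => simp
  | succ n ih =>
    rw [List.replicate_succ', ← List.append_assoc, sepCount, List.foldl_append, ← ih]
    simp [countStep, sepCount]

theorem append_replicate_eq_of_getD_eq {α : Type*} {d : α} {x y : List α}
    (h : ∀ i, x.getD i d = y.getD i d) :
    x ++ List.replicate y.length d = y ++ List.replicate x.length d := by
  refine List.ext_getElem (by simp [add_comm]) fun i _ _ => ?_
  have hi := h i
  simp only [List.getD_eq_getElem?_getD] at hi
  simp only [List.getElem_append, List.getElem_replicate]
  split_ifs <;> simp_all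

theorem sepCount_congr {x y : List TileSymbol} (h : ∀ i, x.getD i 𝟎 = y.getD i 𝟎) :
    sepCount x = sepCount y := by
  rw [← sepCount_append_replicate x y.length, append_replicate_eq_of_getD_eq h,
    sepCount_append_replicate]

/-- A 2-tag system with a halting letter, all of whose productions are nonempty. -/
structure TagSystem (A : Type) where
  prod : A → List A
  halt : A
  prod_ne_nil : ∀ a, prod a ≠ []

namespace TagSystem

variable {A : Type} (T : TagSystem A)

/-- One step of a tag system: the first letter, not the halting one, is read, the first two
letters are deleted, and the production of the first is appended. -/
def Step (u v : List A) : Prop :=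
  ∃ a b w, a ≠ T.halt ∧ u = a :: b :: w ∧ v = w ++ T.prod a

variable [Fintype A] [DecidableEq A]

/-- The letters with a production. -/
noncomputable def letters : List A := (Finset.univ.erase T.halt).toList

/-- The number of a letter; the halting letter has the largest one. -/
noncomputable def number (a : A) : ℕ := T.letters.idxOf a

/-- The productions with the letters replaced by their numbers. -/
noncomputable def productions : List (List ℕ) := T.letters.map fun a => (T.prod a).map T.number

/-- The tape with a word of the tag system. -/
noncomputable def wordGap (n : ℕ) (w : List A) : Gap (Fin 10) TileSymbol :=
  tagGap T.productions n (w.map T.number)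

theorem mem_letters {a : A} : a ∈ T.letters ↔ a ≠ T.halt := by
  simp [letters]

theorem nil_notMem_map_prod (L : List A) : [] ∉ L.map fun a => (T.prod a).map T.number := by
  simp [T.prod_ne_nil]

theorem wordGap_step {u v : List A} (h : T.Step u v) (n : ℕ) :
    ∃ n', Reaches₁ civMachine.gapStep (T.wordGap n u) (T.wordGap n' v) := by
  obtain ⟨a, b, w, ha, rfl, rfl⟩ := h
  obtain ⟨L₁, L₂, hL, haL₁⟩ := List.eq_append_cons_of_mem (T.mem_letters.mpr ha)
  obtain ⟨c, v, hcv⟩ := List.exists_cons_of_ne_nil (T.prod_ne_nil a)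
  obtain ⟨n', hn, h⟩ := tagGap_step (P₂ := L₂.map fun a => (T.prod a).map T.number)
    (T.nil_notMem_map_prod L₁) n (T.number b) (T.number c) (v.map T.number) (w.map T.number)
  have hP : T.productions = (L₁.map fun a => (T.prod a).map T.number) ++
      (T.number c :: v.map T.number) :: L₂.map fun a => (T.prod a).map T.number := by
    simp [productions, hL, hcv]
  have hnumber : T.number a = L₁.length := by
    rw [number, hL, List.idxOf_append_of_notMem haL₁, List.idxOf_cons_self, add_zero]
  have hreach : Reaches civMachine.gapStep (T.wordGap n (a :: b :: w))
      (T.wordGap n' (w ++ T.prod a)) := by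
    simpa only [wordGap, hP, hcv, List.map_cons, List.map_append, hnumber, List.length_map] using h
  refine ⟨n', (Relation.reflTransGen_iff_eq_or_transGen.mp hreach).resolve_left fun heq => ?_⟩
  have := congrArg (fun g => g.l.length) heq
  simp [wordGap, tagGap, chunks] at this
  lia

theorem wordGap_reaches {u v : List A} (h : Relation.TransGen T.Step u v) (n : ℕ) :
    ∃ n', Reaches₁ civMachine.gapStep (T.wordGap n u) (T.wordGap n' v) := by
  induction h with
  | single h => exact T.wordGap_step h n
  | tail _ h ih =>
    obtain ⟨n₁, h₁⟩ := ih
    obtain ⟨n₂, h₂⟩ := T.wordGap_step h n₁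
    exact ⟨n₂, h₁.trans h₂⟩

theorem wordGap_halt (n : ℕ) (b : A) (w : List A) :
    ∃ x, Reaches civMachine.gapStep (T.wordGap n (T.halt :: b :: w)) ⟨.L, 6, [𝟏], x⟩ ∧
      sepCount (𝟏 :: x) = w.length + 1 := by
  have hhalt : T.number T.halt = T.productions.length := by
    rw [number, productions, List.length_map, List.idxOf_eq_length]
    simp [mem_letters]
  obtain ⟨m, hm, h⟩ := tagGap_halt (T.nil_notMem_map_prod T.letters) n (T.number b)
    (w.map T.number)
  have hcount := hm.sepCount_reverse_append_wordCode (T.number b :: w.map T.number)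
  refine ⟨_, ?_, hcount.trans (by simp)⟩
  simpa only [wordGap, List.map_cons, hhalt] using! h

end TagSystem

/-! ### Machines with two numbers -/

section Evens

variable {A : Type*}

/-- The letters of a word that a tag system reads in one pass: every other letter, beginning with
the first. In a word of odd length the last letter has no partner and is left out. -/
def evens : List A → List A
  | a :: _ :: l => a :: evens l
  | _ => []

/-- Both variants of each of the given letters. In one pass, a tag system reads all the `true`
variants, or all the `false` ones if it starts with the second letter. -/
def variants (fs : List (Bool → A)) : List A := fs.flatMap fun f => [f true, f false]

theorem evens_cons_replicate_odd (a b : A) (n : ℕ) :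
    evens (a :: List.replicate (2 * n + 1) b) = a :: List.replicate n b := by
  induction n generalizing a with
  | zero => rfl
  | succ n ih => exact congrArg (a :: ·) (ih b)

theorem evens_cons_replicate_even (a b c : A) (n : ℕ) :
    evens (a :: (List.replicate (2 * n) b ++ [c])) = a :: List.replicate n b := by
  induction n generalizing a with
  | zero => rfl
  | succ n ih => exact congrArg (a :: ·) (ih b)

theorem length_variants (fs : List (Bool → A)) : (variants fs).length = 2 * fs.length := by
  simp [variants, mul_comm]

theorem evens_variants (fs : List (Bool → A)) : evens (variants fs) = fs.map (· true) := by
  induction fs with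
  | nil => rfl
  | cons f fs ih => exact congrArg (f true :: ·) ih

theorem evens_cons_variants (a b : A) (fs : List (Bool → A)) :
    evens (a :: (variants fs ++ [b])) = a :: fs.map (· false) := by
  induction fs generalizing a with
  | nil => rfl
  | cons f fs ih => exact congrArg (a :: ·) (ih (f false))

end Evens

namespace TagSystem

variable {A : Type} (T : TagSystem A)

theorem reaches_evens (l r : List A) (hl : Even l.length) (h : T.halt ∉ evens l) :
    Relation.ReflTransGen T.Step (l ++ r) (r ++ (evens l).flatMap T.prod) := by
  induction l using evens.induct generalizing r with
  | case1 a b l ih =>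
    simp only [evens, List.mem_cons, not_or] at h
    have step : T.Step (a :: b :: l ++ r) (l ++ (r ++ T.prod a)) :=
      ⟨a, b, l ++ r, Ne.symm h.1, rfl, by simp⟩
    have pass := ih (r ++ T.prod a) (by simpa [Nat.even_add_one] using hl) h.2
    exact .head step (by simpa [evens] using pass)
  | case2 l hl' =>
    match l with
    | [] => simpa [evens] using Relation.ReflTransGen.refl
    | [a] => simp at hl
    | a :: b :: l => exact absurd rfl (hl' a b l)

theorem reaches_variants (fs : List (Bool → A)) (r : List A) (h : ∀ f ∈ fs, f true ≠ T.halt) :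
    Relation.ReflTransGen T.Step (variants fs ++ r) (r ++ fs.flatMap fun f => T.prod (f true)) := by
  simpa [evens_variants, List.flatMap_map] using T.reaches_evens (variants fs) r
    (by simp [length_variants]) (by simpa [evens_variants] using h)

/-- If the pass starts with the second letter, the first letter of the first production is left out
as the partner of the last letter read. -/
theorem reaches_tail_variants {f : Bool → A} {fs : List (Bool → A)} (hfs : fs ≠ [])
    (h : ∀ g ∈ f :: fs, g false ≠ T.halt) :
    Relation.ReflTransGen T.Step (variants (f :: fs)).tail
      ((f :: fs).flatMap fun g => T.prod (g false)).tail := by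
  obtain ⟨g, gs, rfl⟩ := List.exists_cons_of_ne_nil hfs
  obtain ⟨a, v, hv⟩ := List.exists_cons_of_ne_nil (T.prod_ne_nil (f false))
  have step : T.Step (variants (f :: g :: gs)).tail ((g false :: variants gs ++ [a]) ++ v) :=
    ⟨f false, g true, g false :: variants gs, h f (by simp), rfl, by simp [hv]⟩
  have pass := T.reaches_evens (g false :: variants gs ++ [a]) v
    (by simp [length_variants, parity_simps])
    (by simpa [evens_cons_variants, ne_comm] using fun g hg => h g (List.mem_cons_of_mem _ hg))
  exact .head step (by simpa [evens_cons_variants, hv, List.flatMap_map] using pass)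

end TagSystem

/-- An affine operation on each of two numbers, after which they may be swapped. -/
structure PairOp where
  mulX : ℕ
  addX : ℕ
  mulY : ℕ
  addY : ℕ
  swap : Bool
  mulX_ne_zero : mulX ≠ 0
  mulY_ne_zero : mulY ≠ 0

/-- The result of an operation. -/
def PairOp.apply (o : PairOp) (x y : ℕ) : ℕ × ℕ :=
  if o.swap then (o.mulY * y + o.addY, o.mulX * x + o.addX)
  else (o.mulX * x + o.addX, o.mulY * y + o.addY)

/-- A machine with two numbers: in each step the last bit of the second number is removed, and it
determines the next state (`none` is the halting state) and an operation on the numbers. -/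
structure PairMachine (σ : Type) where
  next : σ → Bool → Option σ
  op : σ → Bool → PairOp

namespace PairMachine

variable {σ : Type} (M : PairMachine σ)

/-- One step. -/
def step : Option σ × ℕ × ℕ → Option (Option σ × ℕ × ℕ)
  | (none, _, _) => none
  | (some q, x, y) => some (M.next q y.bodd, (M.op q y.bodd).apply x y.div2)

/-- Letters of the tag system that simulates the machine. The letters of the first line make up the
words that stand for configurations; the others occur while a step is simulated. -/
inductive Letter (σ : Type)
  | markX (q : Option σ) | unitX (q : Option σ) | markY (q : Option σ) | unitY (q : Option σ)
  | readMarkX (q : σ) (c : Bool) | readUnitX (q : σ) (c : Bool)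
  | readMarkY (q : σ) (c : Bool) | readUnitY (q : σ) (c : Bool)
  | swapMark (q : σ) (c : Bool) | swapUnit (q : σ) (c : Bool)
  deriving DecidableEq, Fintype

open Letter

/-- The part of a word that stands for the first number. Its length is even, so that the pass over
it does not depend on the number. -/
def wordX (q : Option σ) (x : ℕ) : List (Letter σ) :=
  markX q :: List.replicate (2 * x + 1) (unitX q)

/-- The part of a word that stands for the second number. -/
def wordY (q : Option σ) (y : ℕ) : List (Letter σ) :=
  markY q :: List.replicate y (unitY q)

/-- The word that stands for a configuration. -/
def word : Option σ × ℕ × ℕ → List (Letter σ)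
  | (q, x, y) => wordX q x ++ wordY q y

/-- The productions. The variant `c` of the letters `readMarkX q`, … is read if the last bit of the
second number is `c`. For `c = false`, `readMarkX q c` produces an additional letter, which
restores the alignment. -/
def prod : Letter σ → List (Letter σ)
  | markX (some q) => variants [readMarkX q]
  | unitX (some q) => variants [readUnitX q]
  | markY (some q) => variants [readMarkY q]
  | unitY (some q) => variants [readUnitY q]
  | readMarkX q c => (if c then [] else [markX none]) ++
      if (M.op q c).swap then variants [fun _ => swapMark q c]
      else wordX (M.next q c) (M.op q c).addX
  | readUnitX q c =>
      if (M.op q c).swap then variants [fun _ => swapUnit q c]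
      else List.replicate (2 * (M.op q c).mulX) (unitX (M.next q c))
  | readMarkY q c =>
      if (M.op q c).swap then wordX (M.next q c) (M.op q c).addY
      else wordY (M.next q c) (M.op q c).addY
  | readUnitY q c =>
      if (M.op q c).swap then List.replicate (2 * (M.op q c).mulY) (unitX (M.next q c))
      else List.replicate (M.op q c).mulY (unitY (M.next q c))
  | swapMark q c => wordY (M.next q c) (M.op q c).addX
  | swapUnit q c => List.replicate (M.op q c).mulX (unitY (M.next q c))
  | _ => [markX none]

theorem prod_ne_nil (a : Letter σ) : M.prod a ≠ [] := by
  have hX := fun q c => (M.op q c).mulX_ne_zero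
  have hY := fun q c => (M.op q c).mulY_ne_zero
  cases a with
  | markX q => cases q <;> simp [prod, variants]
  | unitX q => cases q <;> simp [prod, variants]
  | markY q => cases q <;> simp [prod, variants]
  | unitY q => cases q <;> simp [prod, variants]
  | _ => simp only [prod, wordX, wordY]; (try split_ifs) <;> simp [variants, hX, hY]

/-- The tag system that simulates the machine. -/
def tagSystem : TagSystem (Letter σ) := ⟨M.prod, markX none, M.prod_ne_nil⟩

theorem wordX_append_flatten_replicate (q : Option σ) (x n m : ℕ) :
    wordX q x ++ (List.replicate n (List.replicate (2 * m) (unitX q))).flatten =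
      wordX q (m * n + x) := by
  rw [wordX, wordX, List.flatten_replicate_replicate, List.cons_append,
    List.replicate_append_replicate]
  congr 2
  ring

theorem wordY_append_flatten_replicate (q : Option σ) (y n m : ℕ) :
    wordY q y ++ (List.replicate n (List.replicate m (unitY q))).flatten =
      wordY q (m * n + y) := by
  rw [wordY, wordY, List.flatten_replicate_replicate, List.cons_append,
    List.replicate_append_replicate]
  congr 2
  ring

/-- The letters, without their variant, of the word after the first pass. -/
def readLetters (q : σ) (x y : ℕ) : List (Bool → Letter σ) :=
  readMarkX q ::
    (List.replicate x (readUnitX q) ++ readMarkY q :: List.replicate y (readUnitY q))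

theorem readLetters_ne_halt {q : σ} {x y : ℕ} {f : Bool → Letter σ} (hf : f ∈ readLetters q x y)
    (c : Bool) : f c ≠ M.tagSystem.halt := by
  simp only [readLetters, List.mem_cons, List.mem_append,
    List.mem_replicate] at hf
  rcases hf with rfl | ⟨-, rfl⟩ | rfl | ⟨-, rfl⟩ <;> simp [tagSystem]

theorem word_first_pass (q : σ) (x y : ℕ) :
    Relation.TransGen M.tagSystem.Step (word (some q, x, y))
      ((variants (readLetters q x y.div2)).drop (if y.bodd then 0 else 1)) := by
  have pass_x : Relation.TransGen M.tagSystem.Step (word (some q, x, y))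
      (wordY (some q) y ++ variants (readMarkX q :: List.replicate x (readUnitX q))) := by
    have h := M.tagSystem.reaches_evens (wordX (some q) x) (wordY (some q) y)
      (by simp [wordX, parity_simps]) (by simp [wordX, evens_cons_replicate_odd, tagSystem])
    have produced : (evens (wordX (some q) x)).flatMap M.tagSystem.prod =
        variants (readMarkX q :: List.replicate x (readUnitX q)) := by
      simp [wordX, evens_cons_replicate_odd, tagSystem, prod, variants, List.flatMap_replicate]
    rw [produced] at h
    refine (Relation.reflTransGen_iff_eq_or_transGen.mp h).resolve_left ?_
    simp [wordX, wordY]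
  refine pass_x.trans_left ?_
  obtain ⟨k, rfl | rfl⟩ := Nat.even_or_odd' y
  · have h := M.tagSystem.reaches_evens
      (markY (some q) :: List.replicate (2 * k) (unitY (some q)) ++ [readMarkX q true])
      (readMarkX q false :: variants (List.replicate x (readUnitX q)))
      (by simp [parity_simps]) (by simp [evens_cons_replicate_even, tagSystem])
    rw [List.cons_append, evens_cons_replicate_even] at h
    simpa [tagSystem, wordY, prod, variants, readLetters, Nat.div2_val, List.flatMap_replicate]
      using! h
  · have h := M.tagSystem.reaches_evens (wordY (some q) (2 * k + 1))
      (variants (readMarkX q :: List.replicate x (readUnitX q)))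
      (by simp [wordY, parity_simps]) (by simp [wordY, evens_cons_replicate_odd, tagSystem])
    rw [wordY, evens_cons_replicate_odd] at h
    have hk : (2 * k + 1).div2 = k := by simp [Nat.div2_val]
    simpa [tagSystem, wordY, prod, variants, readLetters, hk, List.flatMap_replicate] using! h

theorem word_second_pass (q : σ) (c : Bool) (x y : ℕ) :
    Relation.ReflTransGen M.tagSystem.Step
      ((variants (readLetters q x y)).drop (if c then 0 else 1))
      (((readLetters q x y).flatMap fun f => M.prod (f c)).drop (if c then 0 else 1)) := by
  cases c
  · simpa only [Bool.false_eq_true, if_false, List.drop_one] using!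
      M.tagSystem.reaches_tail_variants (by simp)
        fun f hf => M.readLetters_ne_halt (q := q) (x := x) (y := y) hf false
  · simpa only [if_true, List.drop_zero, List.append_nil, List.nil_append] using!
      M.tagSystem.reaches_variants (readLetters q x y) []
        fun f hf => M.readLetters_ne_halt hf true

theorem word_third_pass (q : σ) (c : Bool) (x y : ℕ) :
    Relation.ReflTransGen M.tagSystem.Step
      (((readLetters q x y).flatMap fun f => M.prod (f c)).drop (if c then 0 else 1))
      (word (M.next q c, (M.op q c).apply x y)) := by
  have drop_prod_readMarkX : (M.prod (readMarkX q c)).drop (if c then 0 else 1) =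
      if (M.op q c).swap then variants [fun _ => swapMark q c]
      else wordX (M.next q c) (M.op q c).addX := by
    cases c <;> simp [prod]
  have word_eq : ((readLetters q x y).flatMap fun f => M.prod (f c)).drop (if c then 0 else 1) =
      (M.prod (readMarkX q c)).drop (if c then 0 else 1) ++
        ((List.replicate x (M.prod (readUnitX q c))).flatten ++ (M.prod (readMarkY q c) ++
          (List.replicate y (M.prod (readUnitY q c))).flatten)) := by
    cases c <;> simp [readLetters, List.flatMap_replicate, List.drop_append_of_le_length,
      List.tail_append_of_ne_nil, M.prod_ne_nil]
  rw [word_eq, drop_prod_readMarkX]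
  cases hs : (M.op q c).swap
  · simp only [prod, hs, PairOp.apply, word, Bool.false_eq_true, if_false, ← List.append_assoc,
      wordX_append_flatten_replicate]
    simp only [List.append_assoc, wordY_append_flatten_replicate]
    rfl
  · have pass := M.tagSystem.reaches_variants
      ((fun _ => swapMark q c) :: List.replicate x fun _ => swapUnit q c)
      (wordX (M.next q c) ((M.op q c).mulY * y + (M.op q c).addY)) (by simp [tagSystem])
    rw [List.flatMap_cons, List.flatMap_replicate] at pass
    simp only [prod, hs, PairOp.apply, word, if_true, wordX_append_flatten_replicate,
      ← wordY_append_flatten_replicate]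
    simpa [variants, List.flatMap_replicate, -List.flatten_replicate_replicate] using! pass

theorem word_step {c c' : Option σ × ℕ × ℕ} (h : c' ∈ M.step c) :
    Relation.TransGen M.tagSystem.Step (word c) (word c') := by
  obtain ⟨q | q, x, y⟩ := c
  · simp [step] at h
  · obtain rfl := Option.some.inj h
    exact ((M.word_first_pass q x y).trans_left (M.word_second_pass q _ x _)).trans_left
      (M.word_third_pass q _ x _)

end PairMachine

theorem TuringMachine.haltsAt_iff_mem_eval {Q Γ : Type} (M : TuringMachine Q Γ) (c d : Cfg Q Γ) :
    M.HaltsAt c d ↔ d ∈ eval M.step c :=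
  mem_eval.symm

namespace PairMachine

variable {σ : Type} [Fintype σ] [DecidableEq σ] (M : PairMachine σ)

/-- The configurations of the machine of the command table that simulate a configuration of `M`. A
halting configuration can be read off the tape: twice the first number plus the second one is the
number of separators minus `2`. -/
def Simulates : Option σ × ℕ × ℕ → Cfg (Fin 10) TileSymbol → Prop
  | (some q, x, y), c => ∃ n p, c = (M.tagSystem.wordGap n (word (some q, x, y))).toCfg 𝟎 p
  | (none, x, y), c =>
    ∃ r p, c = (Gap.mk .L 6 [𝟏] r).toCfg 𝟎 p ∧ sepCount (𝟏 :: r) = 2 * x + y + 2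

theorem exists_simulates (c : Option σ × ℕ × ℕ) (n : ℕ) (p : ℤ) : ∃ d, M.Simulates c d ∧
    Reaches civMachine.step ((M.tagSystem.wordGap n (word c)).toCfg 𝟎 p) d := by
  obtain ⟨q | q, x, y⟩ := c
  · obtain ⟨r, h, hr⟩ := M.tagSystem.wordGap_halt n (.unitX none)
      (List.replicate (2 * x) (.unitX none) ++ wordY none y)
    obtain ⟨_, ⟨p', rfl⟩, h'⟩ := tr_reaches civMachine.gapStep_respects ⟨p, rfl⟩ h
    refine ⟨_, ⟨r, p', rfl, ?_⟩, h'⟩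
    rw [hr]
    simp only [wordY, List.length_append, List.length_cons, List.length_replicate]
    lia
  · exact ⟨_, ⟨n, p, rfl⟩, .refl⟩

theorem simulates_respects : Respects M.step civMachine.step M.Simulates := by
  rintro ⟨q | q, x, y⟩ c h
  · obtain ⟨r, p, rfl, -⟩ := h
    exact civMachine.gapStep_respects (a₁ := Gap.mk .L 6 [𝟏] r) ⟨p, rfl⟩
  · obtain ⟨n, p, rfl⟩ := h
    obtain ⟨n', h₁⟩ := M.tagSystem.wordGap_reaches (M.word_step (c := (some q, x, y)) rfl) n
    obtain ⟨_, ⟨p', rfl⟩, h₁⟩ := tr_reaches₁ civMachine.gapStep_respects ⟨p, rfl⟩ h₁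
    obtain ⟨d, hd, h₂⟩ := M.exists_simulates _ n' p'
    exact ⟨d, hd, h₁.trans_left h₂⟩

/-- The initial tape of the machine of the command table for the state `q` and the numbers `0`
and `y`. -/
noncomputable def tape (q : σ) (y : ℕ) : List TileSymbol × List TileSymbol :=
  ((M.tagSystem.wordGap 0 (word (some q, 0, y))).l,
    (M.tagSystem.wordGap 0 (word (some q, 0, y))).r)

theorem simulates_init (q : σ) (y : ℕ) :
    M.Simulates (some q, 0, y) (civMachine.init (M.tape q y)) :=
  ⟨0, 0, civMachine.init_eq_toCfg _ _⟩

theorem exists_haltsAt_iff (q : σ) (y : ℕ) :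
    (∃ d, civMachine.HaltsAt (civMachine.init (M.tape q y)) d) ↔
      (eval M.step (some q, 0, y)).Dom := by
  simp only [TuringMachine.haltsAt_iff_mem_eval, ← Part.dom_iff_mem]
  exact tr_eval_dom M.simulates_respects (M.simulates_init q y)

theorem sepCount_of_haltsAt {q : σ} {y x' y' : ℕ} {q' : Option σ} {d : Cfg (Fin 10) TileSymbol}
    {z : List TileSymbol × List TileSymbol}
    (hd : civMachine.HaltsAt (civMachine.init (M.tape q y)) d)
    (h : (q', x', y') ∈ eval M.step (some q, 0, y)) (hz : civMachine.HasContent d z) :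
    sepCount z.2 = 2 * x' + y' + 2 := by
  obtain ⟨d', hd', hmem⟩ := tr_eval M.simulates_respects (M.simulates_init q y) h
  obtain rfl := Part.mem_unique hmem ((civMachine.haltsAt_iff_mem_eval _ _).mp hd)
  cases q' with
  | some q' => simp [mem_eval, step] at h
  | none =>
    obtain ⟨r, p, rfl, hr⟩ := hd'
    rw [← hr]
    refine sepCount_congr fun i => (hz i).1.symm.trans ?_
    cases i <;> simp [Gap.toCfg, gapTape]

end PairMachine

/-! ### Turing machines with two symbols -/

section TwoSymbols

open Turing

/-- The number with the given binary digits, the last one first. -/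
def bitsNum (l : List Bool) : ℕ := l.foldr Nat.bit 0

theorem bitsNum_append_replicate_false (l : List Bool) (n : ℕ) :
    bitsNum (l ++ List.replicate n false) = bitsNum l := by
  have bitsNum_replicate : (List.replicate n false).foldr Nat.bit 0 = 0 := by
    induction n with
    | zero => rfl
    | succ n ih => rw [List.replicate_succ, List.foldr_cons, ih, Nat.bit_false_zero]
  rw [bitsNum, List.foldr_append, bitsNum_replicate, bitsNum]

/-- The number whose binary digits are written on a half of the tape. -/
def blankNum (l : ListBlank Bool) : ℕ :=
  l.liftOn bitsNum <| by
    rintro a _ ⟨n, rfl⟩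
    exact (bitsNum_append_replicate_false a n).symm

theorem blankNum_cons (b : Bool) (l : ListBlank Bool) :
    blankNum (l.cons b) = Nat.bit b (blankNum l) := by
  induction l using ListBlank.induction_on
  rfl

theorem bit_head_blankNum_tail (l : ListBlank Bool) :
    Nat.bit l.head (blankNum l.tail) = blankNum l := by
  rw [← blankNum_cons, ListBlank.cons_head_tail]

/-- The numbers on the two halves of a tape; the second half begins with the cell under the
head. -/
def tapeNums (T : Tape Bool) : ℕ × ℕ := (blankNum T.left, blankNum T.right₀)

theorem tapeNums_mk' (L R : ListBlank Bool) :
    tapeNums (Tape.mk' L R) = (blankNum L, blankNum R) := by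
  rw [tapeNums, Tape.mk'_left, Tape.mk'_right₀]

/-- Write the bit `b` back to the second number. -/
def PairOp.keep (b swap : Bool) : PairOp := ⟨1, 0, 2, b.toNat, swap, by simp, by simp⟩

/-- Append the bit `b` to the first number. -/
def PairOp.push (b swap : Bool) : PairOp := ⟨2, b.toNat, 1, 0, swap, by simp, by simp⟩

theorem PairOp.keep_apply (b swap : Bool) (x y : ℕ) :
    (PairOp.keep b swap).apply x y = if swap then (Nat.bit b y, x) else (x, Nat.bit b y) := by
  simp [PairOp.apply, PairOp.keep, Nat.bit_val]

theorem PairOp.push_apply (b swap : Bool) (x y : ℕ) :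
    (PairOp.push b swap).apply x y = if swap then (y, Nat.bit b x) else (Nat.bit b x, y) := by
  simp [PairOp.apply, PairOp.push, Nat.bit_val]

namespace PairMachine

variable {Λ : Type} [Inhabited Λ] [DecidableEq Λ] (M : TM0.Machine Bool Λ) (S : Finset Λ)

/-- The state `(q, b)` if `q` is in `S`, and the halting state otherwise. -/
def restrictState (b : Bool) (q : Λ) : Option (S × Bool) :=
  if h : q ∈ S then some (⟨q, h⟩, b) else none

/-- The machine with two numbers for a Turing machine with two symbols and states in `S`. To move
the head to the left, it first swaps the numbers; then, in the state `(q, true)`, it moves a bit and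
swaps the numbers back. -/
def ofTM0 : PairMachine (S × Bool) where
  next
    | (q, false), b => match M q b with
      | none => none
      | some (q', .move .left) => restrictState S true q'
      | some (q', _) => restrictState S false q'
    | (q, true), _ => some (q, false)
  op
    | (q, false), b => match M q b with
      | none => .keep b false
      | some (_, .move .left) => .keep b true
      | some (_, .move .right) => .push b false
      | some (_, .write a) => .keep a false
    | (_, true), b => .push b true

variable {M S}

theorem ofTM0_reaches {q q' : Λ} (hq : q ∈ S) (hq' : q' ∈ S) {T T' : Tape Bool}
    (h : TM0.step M ⟨q, T⟩ = some ⟨q', T'⟩) : Reaches₁ (ofTM0 M S).step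
      (some (⟨q, hq⟩, false), tapeNums T) (some (⟨q', hq'⟩, false), tapeNums T') := by
  obtain ⟨L, R, rfl⟩ := T.exists_mk'
  simp only [TM0.step, Tape.mk'_head, Option.map_eq_some_iff, TM0.Cfg.mk.injEq] at h
  obtain ⟨⟨_, s⟩, hM, rfl, hT⟩ := h
  rcases s with (_ | _) | a <;> dsimp only at hT <;> subst hT
  · have swap : (ofTM0 M S).step (some (⟨q, hq⟩, false), tapeNums (Tape.mk' L R)) =
        some (some (⟨_, hq'⟩, true), blankNum R, blankNum L) := by
      rw [tapeNums_mk', ← bit_head_blankNum_tail R]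
      simp [step, ofTM0, hM, restrictState, hq', PairOp.keep_apply]
    have move : (ofTM0 M S).step (some (⟨_, hq'⟩, true), blankNum R, blankNum L) =
        some (some (⟨_, hq'⟩, false), tapeNums ((Tape.mk' L R).move .left)) := by
      rw [Tape.move_left_mk', tapeNums_mk', blankNum_cons, ← bit_head_blankNum_tail L]
      simp [step, ofTM0, PairOp.push_apply]
    exact .tail (.single swap) move
  · refine .single ?_
    rw [Tape.move_right_mk', tapeNums_mk', tapeNums_mk', blankNum_cons, ← bit_head_blankNum_tail R]
    simp [step, ofTM0, hM, restrictState, hq', PairOp.push_apply]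
  · refine .single ?_
    rw [Tape.write_mk', tapeNums_mk', tapeNums_mk', blankNum_cons, ← bit_head_blankNum_tail R]
    simp [step, ofTM0, hM, restrictState, hq', PairOp.keep_apply]

theorem ofTM0_halts {q : Λ} (hq : q ∈ S) {T : Tape Bool} (h : TM0.step M ⟨q, T⟩ = none) :
    (ofTM0 M S).step (some (⟨q, hq⟩, false), tapeNums T) = some (none, tapeNums T) := by
  obtain ⟨L, R, rfl⟩ := T.exists_mk'
  simp only [TM0.step, Tape.mk'_head, Option.map_eq_none_iff] at h
  rw [tapeNums_mk', ← bit_head_blankNum_tail R]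
  simp [step, ofTM0, h, PairOp.keep_apply]

/-- The configuration of `ofTM0 M S` for a configuration of `M`; the halting state is entered as
soon as `M` has halted. -/
def RepresentsTM0 (M : TM0.Machine Bool Λ) (S : Finset Λ) (c : TM0.Cfg Bool Λ)
    (d : Option (S × Bool) × ℕ × ℕ) : Prop :=
  (TM0.step M c = none ∧ d = (none, tapeNums c.Tape)) ∨
    TM0.step M c ≠ none ∧ ∃ hq : c.q ∈ S, d = (some (⟨c.q, hq⟩, false), tapeNums c.Tape)

theorem exists_representsTM0 {c : TM0.Cfg Bool Λ} (hq : c.q ∈ S) :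
    ∃ d, RepresentsTM0 M S c d ∧
      Reaches (ofTM0 M S).step (some (⟨c.q, hq⟩, false), tapeNums c.Tape) d := by
  by_cases h : TM0.step M c = none
  · exact ⟨_, .inl ⟨h, rfl⟩, .single (ofTM0_halts hq h)⟩
  · exact ⟨_, .inr ⟨h, hq, rfl⟩, .refl⟩

theorem representsTM0_respects (hS : TM0.Supports M (S : Set Λ)) :
    Respects (TM0.step M) (ofTM0 M S).step (RepresentsTM0 M S) := by
  rintro c d (⟨h, rfl⟩ | ⟨h, hq, rfl⟩)
  · rw [h]
    rfl
  · obtain ⟨c', hc'⟩ := Option.ne_none_iff_exists'.mp h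
    have hq' : c'.q ∈ S := TM0.step_supports M hS hc' hq
    obtain ⟨d, hd, h'⟩ := exists_representsTM0 (M := M) hq'
    rw [hc']
    exact ⟨d, hd, (ofTM0_reaches hq hq' hc').trans_left h'⟩

theorem eval_ofTM0_dom (hS : TM0.Supports M (S : Set Λ)) {c : TM0.Cfg Bool Λ} (hq : c.q ∈ S) :
    (eval (ofTM0 M S).step (some (⟨c.q, hq⟩, false), tapeNums c.Tape)).Dom ↔
      (eval (TM0.step M) c).Dom := by
  obtain ⟨d, hd, h⟩ := exists_representsTM0 (M := M) hq
  rw [reaches_eval h]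
  exact tr_eval_dom (representsTM0_respects hS) hd

theorem mem_eval_ofTM0 (hS : TM0.Supports M (S : Set Λ)) {c c' : TM0.Cfg Bool Λ} (hq : c.q ∈ S)
    (h' : c' ∈ eval (TM0.step M) c) : (none, tapeNums c'.Tape) ∈
      eval (ofTM0 M S).step (some (⟨c.q, hq⟩, false), tapeNums c.Tape) := by
  obtain ⟨d, hd, h⟩ := exists_representsTM0 (M := M) hq
  rw [reaches_eval h]
  obtain ⟨d', hd', h''⟩ := tr_eval (representsTM0_respects hS) hd h'
  rcases hd' with ⟨-, rfl⟩ | ⟨hne, -⟩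
  · exact h''
  · exact absurd (mem_eval.mp h').2 hne

end PairMachine

end TwoSymbols

/-! ### Numbers with coded binary digits -/

theorem primrec_bits : Primrec Nat.bits := by
  let g (_ : Unit) (l : List (List Bool)) : Option (List Bool) :=
    if l.length = 0 then some [] else l[l.length.div2]?.map (l.length.bodd :: ·)
  have hlength : Primrec fun p : Unit × List (List Bool) => p.2.length :=
    Primrec.list_length.comp .snd
  have hg : Primrec₂ g := by
    refine Primrec.ite (Primrec.eq.comp hlength (.const 0)) (.const _) ?_
    refine Primrec.option_map (Primrec.list_getElem?.comp .snd (Primrec.nat_div2.comp hlength)) ?_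
    exact Primrec.list_cons.comp (Primrec.nat_bodd.comp (hlength.comp .fst)) .snd
  refine (Primrec.nat_strong_rec (fun (_ : Unit) => Nat.bits) hg fun _ n => ?_).comp
    (.const ()) .id
  rcases eq_or_ne n 0 with rfl | hn
  · simp [g]
  · have hdiv : n.div2 < n := Nat.binaryRec_decreasing hn
    have hbits : n.bits = n.bodd :: n.div2.bits := by
      conv_lhs => rw [← Nat.bit_bodd_div2 n]
      refine Nat.bits_append_bit _ _ fun hdiv2 => by_contra fun hbodd => hn ?_
      simpa [hdiv2, hbodd] using (Nat.bodd_add_div2 n).symm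
    simp [g, hn, hdiv, hbits]

theorem primrec_ofDigits (b : ℕ) : Primrec fun l : List ℕ => Nat.ofDigits b l := by
  have hstep : Primrec₂ fun (_ : List ℕ) (p : ℕ × ℕ) => p.1 + b * p.2 :=
    Primrec.nat_add.comp (Primrec.fst.comp .snd)
      (Primrec.nat_mul.comp (.const b) (Primrec.snd.comp .snd))
  refine (Primrec.list_foldr .id (.const 0) hstep).of_eq fun l => ?_
  simp [Nat.ofDigits_eq_foldr]

theorem exists_primrec_leftInverse {E : ℕ → ℕ} (hE : Primrec E) (hinj : Function.Injective E)
    (hle : ∀ n, n ≤ E n) : ∃ G : ℕ → ℕ, Primrec G ∧ Function.LeftInverse G E :=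
  ⟨fun y => Nat.findGreatest (fun n => E n = y) y,
    Primrec.nat_findGreatest .id (Primrec.eq.comp (hE.comp .snd) .fst),
    fun n => hinj (Nat.findGreatest_spec (P := fun m => E m = E n) (hle n) rfl)⟩

section DigitCode

variable (b : ℕ) (D : Option Bool → ℕ)

/-- The number in base `b` whose lowest digit is `D none`; the others are the images under `D` of
the binary digits of `n`, the lowest one being the highest here. -/
def digitCode (n : ℕ) : ℕ := Nat.ofDigits b (D none :: n.bits.reverse.map fun c => D (some c))

theorem primrec_digitCode : Primrec (digitCode b D) := by
  refine (primrec_ofDigits b).comp (Primrec.list_cons.comp (.const _) ?_)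
  exact Primrec.list_map (Primrec.list_reverse.comp primrec_bits)
    ((Primrec.dom_finite D).comp (Primrec.option_some.comp .snd))

variable {b D}

theorem digits_digitCode (hb : ∀ c, D c < b) (h0 : ∀ c, D c ≠ 0) (n : ℕ) :
    b.digits (digitCode b D n) = D none :: n.bits.reverse.map fun c => D (some c) := by
  have hD : ∀ a ∈ D none :: n.bits.reverse.map fun c => D (some c), ∃ c, D c = a := by
    simp only [List.mem_cons, List.mem_map]
    rintro _ (rfl | ⟨c, -, rfl⟩) <;> exact ⟨_, rfl⟩
  have one_lt : 1 < b := lt_of_le_of_lt (Nat.one_le_iff_ne_zero.mpr (h0 none)) (hb none)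
  refine Nat.digits_ofDigits b one_lt _ (fun a ha => ?_) fun h => ?_
  · obtain ⟨c, rfl⟩ := hD a ha
    exact hb c
  · obtain ⟨c, hc⟩ := hD _ (List.getLast_mem h)
    exact hc ▸ h0 c

theorem le_digitCode (hb : ∀ c, D c < b) (h0 : ∀ c, D c ≠ 0) (n : ℕ) : n ≤ digitCode b D n := by
  have one_lt : 1 < b := lt_of_le_of_lt (Nat.one_le_iff_ne_zero.mpr (h0 none)) (hb none)
  have size_lt : n.size < (b.digits (digitCode b D n)).length := by
    simp [digits_digitCode hb h0, Nat.size_eq_bits_len]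
  calc n ≤ 2 ^ n.size := (Nat.lt_size_self n).le
    _ ≤ b ^ n.size := Nat.pow_le_pow_left one_lt _
    _ ≤ digitCode b D n := (Nat.lt_digits_length_iff one_lt _).mp size_lt

theorem digitCode_injective (hb : ∀ c, D c < b) (h0 : ∀ c, D c ≠ 0) (hD : Function.Injective D) :
    Function.Injective (digitCode b D) := fun n n' h => by
  have hdigits := congrArg b.digits h
  rw [digits_digitCode hb h0, digits_digitCode hb h0, List.cons.injEq] at hdigits
  have hbits := List.map_injective_iff.mpr (hD.comp (Option.some_injective _)) hdigits.2
  rw [← Nat.digits_inj_iff (b := 2), Nat.digits_two_eq_bits, Nat.digits_two_eq_bits,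
    List.reverse_injective hbits]

end DigitCode

theorem bitsNum_cons (b : Bool) (l : List Bool) : bitsNum (b :: l) = Nat.bit b (bitsNum l) := rfl

theorem bitsNum_append (l l' : List Bool) :
    bitsNum (l ++ l') = bitsNum l + 2 ^ l.length * bitsNum l' := by
  induction l with
  | nil => simp [bitsNum]
  | cons b l ih =>
    rw [List.cons_append, bitsNum_cons, bitsNum_cons, ih, Nat.bit_val, Nat.bit_val,
      List.length_cons]
    ring

theorem bitsNum_lt (l : List Bool) : bitsNum l < 2 ^ l.length := by
  induction l with
  | nil => simp [bitsNum]
  | cons b l ih =>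
    have hb := Bool.toNat_le b
    rw [bitsNum_cons, Nat.bit_val, List.length_cons, pow_succ]
    lia

theorem eq_of_bitsNum_eq {l l' : List Bool} (h : l.length = l'.length)
    (e : bitsNum l = bitsNum l') : l = l' := by
  induction l generalizing l' with
  | nil => exact (List.length_eq_zero_iff.mp h.symm).symm
  | cons b l ih =>
    obtain ⟨b', l', rfl⟩ := List.exists_cons_of_length_eq_add_one h.symm
    rw [bitsNum_cons, bitsNum_cons] at e
    have hb : b = b' := by simpa using congrArg Nat.bodd e
    have hl : bitsNum l = bitsNum l' := by simpa using congrArg Nat.div2 e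
    rw [hb, ih (Nat.succ_injective h) hl]

theorem bitsNum_flatMap {α : Type*} {m : ℕ} (f : α → List.Vector Bool m) (l : List α) :
    bitsNum (l.flatMap fun a => (f a).toList) =
      Nat.ofDigits (2 ^ m) (l.map fun a => bitsNum (f a).toList) := by
  induction l with
  | nil => simp [bitsNum]
  | cons a l ih =>
    rw [List.flatMap_cons, bitsNum_append, ih, List.Vector.toList_length, List.map_cons,
      Nat.ofDigits_cons]

/-! ### Partial recursive functions on machines with two numbers -/

section PartialRecursive

open Turing

theorem tapeNums_trCfg {Γ Λ σ : Type} [Inhabited Γ] {m : ℕ} {enc : Γ → List.Vector Bool m}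
    (enc0 : enc default = List.Vector.replicate m false)
    (M : TM1to1.Λ' Γ Λ σ → TM1.Stmt Bool (TM1to1.Λ' Γ Λ σ) σ) (q : Option Λ) (v : σ)
    (l : List Γ) :
    tapeNums (TM1to0.trCfg M (TM1to1.trCfg enc enc0 ⟨q, v, Tape.mk₁ l⟩)).Tape =
      (0, Nat.ofDigits (2 ^ m) (l.map fun a => bitsNum (enc a).toList)) := by
  have tape_trCfg : (TM1to0.trCfg M (TM1to1.trCfg enc enc0 ⟨q, v, Tape.mk₁ l⟩)).Tape =
      Tape.mk' ∅ (ListBlank.mk (l.flatMap fun a => (enc a).toList)) := by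
    simp only [TM1to0.trCfg, TM1to1.trCfg, Tape.mk₁, Tape.mk₂, TM1to1.trTape_mk',
      TM1to1.trTape', ListBlank.flatMap_mk]
    rfl
  rw [tape_trCfg, tapeNums_mk', ← bitsNum_flatMap]
  rfl

/-- The letters become digits in base `b`; the letter under the head is the lowest digit. -/
theorem exists_pairMachine_of_TM1 {Γ Λ σ : Type} [Inhabited Γ] [Finite Γ] [Inhabited Λ]
    [Inhabited σ] [Finite σ] (M : Λ → TM1.Stmt Γ Λ σ) {S : Finset Λ} (hS : TM1.Supports M S) :
    ∃ (b : ℕ) (D : Γ → ℕ), (∀ a, D a < b) ∧ D default = 0 ∧ Function.Injective D ∧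
      ∃ (τ : Type) (_ : Fintype τ) (_ : DecidableEq τ) (P : PairMachine τ) (q : τ), ∀ l,
        ((eval P.step (some q, 0, Nat.ofDigits b (l.map D))).Dom ↔
          (eval (TM1.step M) (TM1.init l)).Dom) ∧
        ∀ v l', ⟨none, v, Tape.mk₁ l'⟩ ∈ eval (TM1.step M) (TM1.init l) →
          (none, 0, Nat.ofDigits b (l'.map D)) ∈
            eval P.step (some q, 0, Nat.ofDigits b (l.map D)) := by
  classical
  have := Fintype.ofFinite Γ
  have := Fintype.ofFinite σ
  obtain ⟨m, enc, dec, enc0, encdec⟩ := TM1to1.exists_enc_dec (Γ := Γ)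
  let M' := TM1to1.tr enc dec M
  let S' := TM1to0.trStmts M' (TM1to1.trSupp M S)
  have hS' : TM0.Supports (TM1to0.tr M') (S' : Set (TM1to0.Λ' M')) :=
    TM1to0.tr_supports _ (TM1to1.tr_supports _ _ _ hS)
  let tr (c : TM1.Cfg Γ Λ σ) := TM1to0.trCfg M' (TM1to1.trCfg enc enc0 c)
  have tapeNums_init (l) : tapeNums (tr (TM1.init l)).Tape = _ := tapeNums_trCfg enc0 M' _ _ l
  have start_mem (l) : (tr (TM1.init l)).q ∈ S' := hS'.1
  refine ⟨2 ^ m, fun a => bitsNum (enc a).toList, fun a => ?_, ?_, fun a a' h => ?_, _,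
    inferInstance, inferInstance, PairMachine.ofTM0 (TM1to0.tr M') S',
    (⟨_, start_mem []⟩, false), fun l => ⟨?_, fun v l' hl' => ?_⟩⟩
  · simpa using bitsNum_lt (enc a).toList
  · dsimp only
    rw [enc0]
    exact bitsNum_append_replicate_false [] m
  · rw [← encdec a, ← encdec a', List.Vector.toList_injective (eq_of_bitsNum_eq (by simp) h)]
  · have dom_iff := PairMachine.eval_ofTM0_dom hS' (start_mem l)
    rw [tapeNums_init] at dom_iff
    refine dom_iff.trans ?_
    rw [tr_eval_dom (TM1to0.tr_respects M') rfl, tr_eval_dom (TM1to1.tr_respects dec M encdec) rfl]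
  · obtain ⟨_, rfl, hd⟩ := tr_eval (TM1to1.tr_respects dec M encdec) rfl hl'
    obtain ⟨_, rfl, hd⟩ := tr_eval (TM1to0.tr_respects M') rfl hd
    have mem_eval :=
      PairMachine.mem_eval_ofTM0 (c' := tr ⟨none, v, Tape.mk₁ l'⟩) hS' (start_mem l) hd
    rw [tapeNums_trCfg, tapeNums_init] at mem_eval
    exact mem_eval

open Turing.PartrecToTM2

/-- The stack symbol of a binary digit. -/
def bitSymbol (b : Bool) : Γ' := cond b .bit1 .bit0

theorem bitSymbol_injective : Function.Injective bitSymbol := by decide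

theorem trPosNum_eq_map_bits (n : PosNum) : trPosNum n = (n : ℕ).bits.map bitSymbol := by
  induction n with
  | one => simp [trPosNum, bitSymbol]
  | bit0 n ih =>
    rw [trPosNum, ih, PosNum.cast_bit0, ← two_mul, Nat.bit0_bits _ (PosNum.cast_pos n).ne']
    rfl
  | bit1 n ih =>
    rw [trPosNum, ih, PosNum.cast_bit1, ← two_mul, Nat.bit1_bits]
    rfl

theorem trNat_eq_map_bits (n : ℕ) : trNat n = n.bits.map bitSymbol := by
  rw [trNat]
  conv_rhs => rw [← Num.to_of_nat n]
  cases (n : Num) with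
  | zero => simp [trNum]
  | pos m => exact trPosNum_eq_map_bits m

instance : Fintype K' where
  elems := {K'.main, K'.rev, K'.aux, K'.stack}
  complete := by rintro (_ | _ | _ | _) <;> simp

/-- The symbols of all the stacks at a height where only the main stack has one. -/
def mainSymbol (a : Γ') : ∀ _ : K', Option Γ' :=
  Function.update default .main (some a)

/-- The contents of the stacks when only the main stack is in use. -/
def mainStack (l : List Γ') : ListBlank (∀ _ : K', Option Γ') :=
  ListBlank.mk (l.reverse.map mainSymbol)

theorem map_proj_mainStack (l : List Γ') (k : K') :
    (mainStack l).map (proj k) = ListBlank.mk ((K'.elim l [] [] [] k).map some).reverse := by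
  rw [mainStack, ListBlank.map_mk, List.map_map]
  refine ListBlank.ext fun i => ?_
  rw [ListBlank.nth_mk, ListBlank.nth_mk]
  cases k
  · rw [← List.map_reverse]
    rfl
  all_goals
    simp only [List.getI_eq_getElem?_getD, List.getElem?_map, K'.elim]
    cases l.reverse[i]? <;> rfl

theorem eq_mainStack {l : List Γ'} {L : ListBlank (∀ _ : K', Option Γ')}
    (h : ∀ k, L.map (proj k) = ListBlank.mk ((K'.elim l [] [] [] k).map some).reverse) :
    L = mainStack l :=
  ListBlank.ext fun i => funext fun k => by
    rw [← proj_map_nth, ← proj_map_nth, h, map_proj_mainStack]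

/-- The tape symbol for a symbol of the main stack; it is marked at the bottom of the stack. -/
def tapeSymbol (bottom : Bool) (a : Γ') : TM2to1.Γ' K' (fun _ => Γ') := (bottom, mainSymbol a)

theorem tapeSymbol_injective (bottom : Bool) : Function.Injective (tapeSymbol bottom) :=
  fun _ _ h => Option.some_injective _ (congrFun (congrArg Prod.snd h) K'.main)

theorem tapeSymbol_ne_default (bottom : Bool) (a : Γ') : tapeSymbol bottom a ≠ default :=
  fun h => Option.some_ne_none _ (congrFun (congrArg Prod.snd h) K'.main)

/-- The tape symbols of a binary digit, and of the end of a number for `none`. -/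
def digitSymbol : Option Bool → TM2to1.Γ' K' (fun _ => Γ')
  | none => tapeSymbol true .cons
  | some c => tapeSymbol false (bitSymbol c)

theorem digitSymbol_injective : Function.Injective digitSymbol
  | none, none, _ => rfl
  | none, some _, h | some _, none, h => nomatch congrArg Prod.fst h
  | some _, some _, h => congrArg some (bitSymbol_injective (tapeSymbol_injective false h))

theorem digitSymbol_ne_default (c : Option Bool) : digitSymbol c ≠ default := by
  cases c <;> exact tapeSymbol_ne_default _ _

/-- The tape for the number `n` on the main stack, from the bottom of the stack. -/
def numberTape (n : ℕ) : List (TM2to1.Γ' K' fun _ => Γ') :=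
  digitSymbol none :: n.bits.reverse.map fun c => digitSymbol (some c)

theorem addBottom_mainStack (n : ℕ) :
    TM2to1.addBottom (mainStack (trList [n])) = ListBlank.mk (numberTape n) := by
  have reverse_trList : (trList [n]).reverse = .cons :: n.bits.reverse.map bitSymbol := by
    simp [trList, trNat_eq_map_bits]
  have addBottom_mk (a) (l : List (∀ _ : K', Option Γ')) :
      TM2to1.addBottom (ListBlank.mk (a :: l)) =
        ListBlank.mk ((true, a) :: l.map fun x => (false, x)) := rfl
  rw [mainStack, reverse_trList, List.map_cons, addBottom_mk, List.map_map, List.map_map]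
  rfl

theorem trCfg_numberTape (q : Option PartrecToTM2.Λ') (v : Option Γ') (n : ℕ) :
    TM2to1.TrCfg ⟨q, v, K'.elim (trList [n]) [] [] []⟩
      ⟨q.map TM2to1.Λ'.normal, v, Tape.mk₁ (numberTape n)⟩ := by
  have := TM2to1.TrCfg.mk (q := q) (v := v) _ (map_proj_mainStack (trList [n]))
  rwa [addBottom_mainStack] at this

theorem eq_of_trCfg_halt {n : ℕ} {d : TM1.Cfg (TM2to1.Γ' K' fun _ => Γ') _ (Option Γ')}
    (h : TM2to1.TrCfg (halt [n]) d) : d = ⟨none, none, Tape.mk₁ (numberTape n)⟩ := by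
  obtain ⟨L, hL⟩ := h
  rw [eq_mainStack hL, addBottom_mainStack]
  rfl

theorem eval_TM1_numberTape (c : ToPartrec.Code) (n : ℕ) :
    ((eval (TM1.step (TM2to1.tr PartrecToTM2.tr)) ⟨some (.normal (trNormal c .halt)), none,
      Tape.mk₁ (numberTape n)⟩).Dom ↔ (c.eval [n]).Dom) ∧
    ∀ v, [v] ∈ c.eval [n] → ⟨none, none, Tape.mk₁ (numberTape v)⟩ ∈
      eval (TM1.step (TM2to1.tr PartrecToTM2.tr)) ⟨some (.normal (trNormal c .halt)), none,
        Tape.mk₁ (numberTape n)⟩ := by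
  have h := trCfg_numberTape (some (trNormal c .halt)) none n
  constructor
  · refine (tr_eval_dom (TM2to1.tr_respects PartrecToTM2.tr) h).trans ?_
    exact Eq.to_iff (congrArg Part.Dom (PartrecToTM2.tr_eval c [n]))
  · intro v hv
    have hv' : halt [v] ∈ eval (TM2.step PartrecToTM2.tr) (init c [n]) := by
      rw [PartrecToTM2.tr_eval]
      exact Part.mem_map _ hv
    obtain ⟨d, hd, hd'⟩ := tr_eval (TM2to1.tr_respects PartrecToTM2.tr) h hv'
    rwa [eq_of_trCfg_halt hd] at hd'

theorem exists_pairMachine_of_partrec {f : ℕ →. ℕ} (hf : Partrec f) :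
    ∃ (σ : Type) (_ : Fintype σ) (_ : DecidableEq σ) (M : PairMachine σ) (q : σ) (E G : ℕ → ℕ),
      Primrec E ∧ Primrec G ∧ (∀ n, G (E n) = n) ∧
      ∀ n, ((eval M.step (some q, 0, E n)).Dom ↔ (f n).Dom) ∧
        ∀ v ∈ f n, (none, 0, E v) ∈ eval M.step (some q, 0, E n) := by
  obtain ⟨c, hc⟩ := ToPartrec.Code.exists_code (Nat.Partrec'.part_iff₁.mpr hf)
  have eval_c (n : ℕ) : c.eval [n] = (f n).map fun v => [v] := hc (n ::ᵥ List.Vector.nil)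
  let : Inhabited PartrecToTM2.Λ' := ⟨trNormal c .halt⟩
  obtain ⟨b, D, hDb, hD0, hD, σ, _, _, M, q, hM⟩ := exists_pairMachine_of_TM1
    (TM2to1.tr PartrecToTM2.tr) (TM2to1.tr_supports _ (PartrecToTM2.tr_supports c .halt))
  let D' := D ∘ digitSymbol
  have hD' : Function.Injective D' := hD.comp digitSymbol_injective
  have hD'b (c) : D' c < b := hDb _
  have hD'0 (c) : D' c ≠ 0 := fun h => digitSymbol_ne_default c (hD (h.trans hD0.symm))
  have hE (n : ℕ) : Nat.ofDigits b ((numberTape n).map D) = digitCode b D' n := by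
    rw [numberTape, digitCode, List.map_cons, List.map_map]
    rfl
  obtain ⟨G, hG, hGE⟩ := exists_primrec_leftInverse (primrec_digitCode b D')
    (digitCode_injective hD'b hD'0 hD') (le_digitCode hD'b hD'0)
  refine ⟨σ, inferInstance, inferInstance, M, q, digitCode b D', G, primrec_digitCode b D', hG,
    hGE, fun n => ?_⟩
  obtain ⟨hdom, hval⟩ := hM (numberTape n)
  obtain ⟨hdom', hval'⟩ := eval_TM1_numberTape c n
  rw [hE] at hdom hval
  refine ⟨hdom.trans (hdom'.trans (by rw [eval_c]; rfl)), fun v hv => ?_⟩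
  rw [← hE v]
  exact hval none _ (hval' v (by rw [eval_c]; exact Part.mem_map _ hv))

end PartialRecursive

/-! ### Programs as primitive recursive systems -/

theorem partrec_eval {σ : Type*} [Primcodable σ] {f : σ → Option σ} (hf : Computable f) :
    Partrec (eval f) :=
  Partrec.fix (Computable.of_eq (Computable.option_casesOn hf .sumInl
    (Computable.sumInr.comp .snd).to₂) fun s => by cases f s <;> rfl)

/-- The tape content `x` after writing `a` and moving to `d`, on a tape with the blank `b`. -/
def moveContent {Γ : Type} (b a : Γ) (d : Dir) (x : List Γ × List Γ) : List Γ × List Γ :=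
  if d = .L then (x.1.tail, x.1.headD b :: a :: x.2.tail) else (a :: x.1, x.2.tail)

theorem TuringMachine.HasContent.move {Q Γ : Type} {M : TuringMachine Q Γ} {c : Cfg Q Γ}
    {x : List Γ × List Γ} (h : M.HasContent c x) (q : Q) (a : Γ) (d : Dir) :
    M.HasContent ⟨q, d.shift c.head, Function.update c.tape c.head a⟩
      (moveContent M.blank a d x) := by
  obtain ⟨l, r⟩ := x
  set t := Function.update c.tape c.head a
  have at_head (j : ℤ) (hj : j = c.head) : t j = a := by
    rw [hj]
    exact Function.update_self ..
  have at_left (j : ℤ) (n : ℕ) (hj : j = c.head - 1 - n) : t j = l.getD n M.blank := by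
    rw [hj, ← (h n).2]
    exact Function.update_of_ne (by lia) ..
  have at_right (j : ℤ) (n : ℕ) (hj : j = c.head + 1 + n) : t j = r.tail.getD n M.blank := by
    rw [hj, add_assoc, add_comm 1, ← Nat.cast_succ]
    refine (Function.update_of_ne (by lia) ..).trans ((h (n + 1)).1.trans ?_)
    cases r <;> rfl
  intro n
  cases d
  · refine ⟨?_, (at_left _ (n + 1) ?_).trans ?_⟩
    · rcases n with _ | _ | n
      · refine (at_left _ 0 ?_).trans ?_
        · simp [Dir.shift]
        · cases l <;> rfl
      · exact at_head _ (by simp [Dir.shift])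
      · exact at_right _ n (by simp only [Dir.shift]; lia)
    · simp only [Dir.shift]
      lia
    · cases l <;> rfl
  · refine ⟨at_right _ n rfl, ?_⟩
    rcases n with _ | n
    · exact at_head _ (by simp [Dir.shift])
    · exact at_left _ n (by simp only [Dir.shift]; lia)

namespace Program

/-- One step of a machine on its state and its tape content; the machine is carried along. -/
def listStep (x : Program × ℕ × List ℕ × List ℕ) : Option (Program × ℕ × List ℕ × List ℕ) :=
  (x.1.lookup (x.2.1, x.2.2.2.headD 0)).map fun y => (x.1, y.1, moveContent 0 y.2.1 y.2.2 x.2.2)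

theorem primrec_headD : Primrec fun l : List ℕ => l.headD 0 :=
  (Primrec.option_getD.comp Primrec.list_head? (.const 0)).of_eq fun l => by cases l <;> rfl

theorem primrec_moveContent :
    Primrec fun x : (ℕ × Dir) × List ℕ × List ℕ => moveContent 0 x.1.1 x.1.2 x.2 := by
  have left_part : Primrec fun x : (ℕ × Dir) × List ℕ × List ℕ => x.2.1 := Primrec.fst.comp .snd
  have right_tail : Primrec fun x : (ℕ × Dir) × List ℕ × List ℕ => x.2.2.tail :=
    Primrec.list_tail.comp (Primrec.snd.comp .snd)
  have symbol : Primrec fun x : (ℕ × Dir) × List ℕ × List ℕ => x.1.1 := Primrec.fst.comp .fst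
  exact Primrec.ite (Primrec.eq.comp (Primrec.snd.comp .fst) (.const _))
    (.pair (Primrec.list_tail.comp left_part) (Primrec.list_cons.comp (primrec_headD.comp left_part)
      (Primrec.list_cons.comp symbol right_tail)))
    (.pair (Primrec.list_cons.comp symbol left_part) right_tail)

theorem primrec_listStep : Primrec listStep := by
  rw [show listStep = _ from funext fun x => by
    rw [listStep, lawful_beq_subsingleton instBEqProd instBEqOfDecidableEq]]
  refine Primrec.option_map (Primrec.listLookup.comp (.pair (Primrec.fst.comp .snd)
    (primrec_headD.comp (Primrec.snd.comp (Primrec.snd.comp .snd)))) .fst) ?_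
  refine Primrec.pair (Primrec.fst.comp .fst) (.pair (Primrec.fst.comp .snd) ?_)
  exact primrec_moveContent.comp (.pair (Primrec.snd.comp .snd)
    (Primrec.snd.comp (Primrec.snd.comp .fst)))

/-- The finite object `x` describes the configuration `c` of the machine `p`. -/
def Describes (p : Program) (x : Program × ℕ × List ℕ × List ℕ) (c : Cfg ℕ ℕ) : Prop :=
  x.1 = p ∧ c.state = x.2.1 ∧ p.machine.HasContent c x.2.2

theorem describes_respects (p : Program) : Respects listStep p.machine.step p.Describes := by
  rintro ⟨p', q, l, r⟩ c ⟨hp, hq, hx⟩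
  dsimp only at hp hq hx
  subst hp hq
  have read_eq : c.tape c.head = r.headD 0 := by
    simpa [machine, List.head?_eq_getElem?] using (hx 0).1
  have step_eq : p'.machine.step c = (p'.lookup (c.state, r.headD 0)).map fun y =>
      ⟨y.1, y.2.2.shift c.head, Function.update c.tape c.head y.2.1⟩ :=
    by rw [← read_eq]; rfl
  cases e : p'.lookup (c.state, r.headD 0) with
  | none =>
    rw [e] at step_eq
    simpa only [listStep, e, Option.map_none] using step_eq
  | some y =>
    rw [e] at step_eq
    simp only [listStep, e, Option.map_some]
    exact ⟨_, ⟨rfl, rfl, hx.move _ _ _⟩, .single step_eq⟩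

theorem describes_init (p : Program) (w : List ℕ) :
    p.Describes (p, 0, [], w) (p.machine.init ([], w)) := by
  refine ⟨rfl, rfl, fun i => ⟨?_, ?_⟩⟩
  · simp [TuringMachine.init]
  · have : ¬ 0 ≤ (0 : ℤ) - 1 - i := by lia
    simp only [TuringMachine.init, if_neg this]
    rfl

/-- The function that maps the code of a machine and an input word to the code of the halting
configuration. -/
def haltingCfg (n : ℕ) : Part ℕ :=
  let x : Program × List ℕ := (Encodable.decode n).getD default
  (eval listStep (x.1, 0, [], x.2)).map fun y => Encodable.encode y.2

theorem partrec_haltingCfg : Partrec haltingCfg := by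
  have decoded : Primrec fun n : ℕ => ((Encodable.decode n).getD default : Program × List ℕ) :=
    Primrec.option_getD.comp Primrec.decode (.const default)
  have start : Primrec fun n : ℕ =>
      let x : Program × List ℕ := (Encodable.decode n).getD default
      ((x.1, 0, [], x.2) : Program × ℕ × List ℕ × List ℕ) :=
    Primrec.pair (Primrec.fst.comp decoded)
      (.pair (.const 0) (.pair (.const []) (Primrec.snd.comp decoded)))
  exact Partrec.map ((partrec_eval primrec_listStep.to_comp).comp start.to_comp)
    (Primrec.encode.comp (Primrec.snd.comp .snd)).to_comp

theorem haltingCfg_encode (p : Program) (w : List ℕ) :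
    haltingCfg (Encodable.encode (p, w)) =
      (eval listStep (p, 0, [], w)).map fun y => Encodable.encode y.2 := by
  simp only [haltingCfg, Encodable.encodek, Option.getD_some]

theorem haltingCfg_dom (p : Program) (w : List ℕ) :
    (haltingCfg (Encodable.encode (p, w))).Dom ↔
      ∃ c, p.machine.HaltsAt (p.machine.init ([], w)) c := by
  simp only [TuringMachine.haltsAt_iff_mem_eval, ← Part.dom_iff_mem, haltingCfg_encode]
  exact (tr_eval_dom p.describes_respects (p.describes_init w)).symm

theorem exists_mem_haltingCfg {p : Program} {w : List ℕ} {c : Cfg ℕ ℕ}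
    (h : p.machine.HaltsAt (p.machine.init ([], w)) c) :
    ∃ x : ℕ × List ℕ × List ℕ, Encodable.encode x ∈ haltingCfg (Encodable.encode (p, w)) ∧
      c.state = x.1 ∧ p.machine.HasContent c x.2 := by
  rw [TuringMachine.haltsAt_iff_mem_eval] at h
  obtain ⟨x, ⟨-, hx⟩, hmem⟩ := tr_eval_rev p.describes_respects (p.describes_init w) h
  rw [haltingCfg_encode]
  exact ⟨x.2, Part.mem_map _ hmem, hx⟩

end Program

/-! ### Universality -/

theorem primrec_dropLast {α : Type*} [Primcodable α] : Primrec (List.dropLast (α := α)) :=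
  (Primrec.list_reverse.comp (Primrec.list_tail.comp Primrec.list_reverse)).of_eq fun l => by
    rw [List.tail_reverse, List.reverse_reverse]

theorem primrec_sepCount : Primrec sepCount := by
  have eq_pillagedRoad {f : List TileSymbol × (TileSymbol × ℕ) × TileSymbol → TileSymbol}
      (hf : Primrec f) : PrimrecPred fun x => f x = 𝐛 :=
    Primrec.eq.comp hf (.const _)
  have hstep : Primrec₂ fun (_ : List TileSymbol) (x : (TileSymbol × ℕ) × TileSymbol) =>
      countStep x.1 x.2 := by
    have count : Primrec fun x : List TileSymbol × (TileSymbol × ℕ) × TileSymbol => x.2.1.2 :=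
      Primrec.snd.comp (Primrec.fst.comp .snd)
    exact Primrec.pair (Primrec.snd.comp .snd) (Primrec.ite
      ((eq_pillagedRoad (Primrec.fst.comp (Primrec.fst.comp .snd))).and
        (eq_pillagedRoad (Primrec.snd.comp .snd))) (Primrec.succ.comp count) count)
  exact Primrec.snd.comp (Primrec.list_foldl .id (.const (𝟎, 0)) hstep)

theorem primrec_wordCode_replicate (k : ℕ) :
    Primrec fun n => wordCode (List.replicate n k) := by
  have iterate : Primrec fun n : ℕ => (wordCode [k] ++ ·)^[n] [] :=
    Primrec.nat_iterate .id (.const _) (Primrec.list_append.comp (.const _) .snd)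
  refine iterate.of_eq fun n => ?_
  induction n with
  | zero => rfl
  | succ n ih =>
    rw [Function.iterate_succ_apply', ih, ← wordCode_append]
    rfl

theorem wordCore_eq_dropLast {w : List ℕ} (hw : w ≠ []) :
    wordCore w = (wordCode w).dropLast.dropLast := by
  rw [wordCode_eq hw, List.dropLast_append_of_ne_nil (by simp), List.dropLast_cons_cons]
  simp

theorem PairMachine.primrec_tape {σ : Type} [Fintype σ] [DecidableEq σ] (M : PairMachine σ)
    (q : σ) : Primrec (M.tape q) := by
  let number := M.tagSystem.number
  have hcode : Primrec fun y =>
      wordCode ((wordX (some q) 0 ++ [Letter.markY (some q)]).map number) ++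
        wordCode (List.replicate y (number (.unitY (some q)))) :=
    Primrec.list_append.comp (.const _) (primrec_wordCode_replicate _)
  have hcore := primrec_dropLast.comp (primrec_dropLast.comp hcode)
  refine Primrec.pair (.const _) ((Primrec.list_cons.comp (.const 𝟏) (Primrec.list_cons.comp
    (.const 𝟎) (Primrec.list_append.comp hcore (.const [𝟏])))).of_eq fun y => ?_)
  rw [← wordCode_append, ← wordCore_eq_dropLast (by simp)]
  simp [TagSystem.wordGap, tagGap, word, wordY, number]

theorem isUniversal_civMachine : IsUniversal civMachine := by
  obtain ⟨σ, _, _, M, q, E, G, hE, hG, hGE, hM⟩ :=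
    exists_pairMachine_of_partrec Program.partrec_haltingCfg
  refine ⟨fun x => M.tape q (E (Encodable.encode x)),
    fun x => (Encodable.decode (G (sepCount x.2 - 2))).getD default,
    (M.primrec_tape q).comp (hE.comp Primrec.encode),
    Primrec.option_getD.comp (Primrec.decode.comp (hG.comp (Primrec.nat_sub.comp
      (primrec_sepCount.comp .snd) (.const 2)))) (.const default),
    fun p w => ⟨?_, fun c d hc hd x hx => ?_⟩⟩
  · rw [M.exists_haltsAt_iff, (hM _).1, Program.haltingCfg_dom]
  · obtain ⟨y, hy, hcontent⟩ := Program.exists_mem_haltingCfg hc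
    have hcount := M.sepCount_of_haltsAt hd ((hM _).2 _ hy) hx
    dsimp only
    rw [hcount, mul_zero, zero_add, Nat.add_sub_cancel, hGE, Encodable.encodek]
    exact hcontent

theorem isUTM_civMachine : IsUTM 10 3 civMachine :=
  ⟨by simp, by simp [Nat.card_congr TileSymbol.equivFin], isUniversal_civMachine⟩

theorem rogozhin_δ (q : Fin 10) (a : TileSymbol) :
    rogozhin.δ q (TileSymbol.equivRSymbol a) =
      (civMachine.δ q a).map fun x => (x.1, TileSymbol.equivRSymbol x.2.1, x.2.2) := by
  cases a <;> fin_cases q <;> rfl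

/-! ### Plays -/

section Game

theorem Play.append {W : World} {s₁ s₂ s₃ : GameState} {os os' : List Orders}
    (h : Play W s₁ os s₂) (h' : Play W s₂ os' s₃) : Play W s₁ (os ++ os') s₃ := by
  induction h with
  | nil => exact h'
  | cons h _ ih => exact .cons h (ih h')

theorem Play.single {W : World} {s s' : GameState} {o : Orders} (h : Turn W s o s') :
    Play W s [o] s' :=
  .cons h (.nil _)

/-- The state `s'` can be reached from `s` by orders that satisfy `P`, within `a` turns, of which
at most `b` are turns of work. -/
def CanReach (W : World) (P : Orders → Prop) (a b : ℕ) (s s' : GameState) : Prop :=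
  ∃ os : List Orders, (∀ o ∈ os, P o) ∧ Play W s os s' ∧ os.length ≤ a ∧
    (os.filter Orders.isWork).length ≤ b

namespace CanReach

variable {W : World} {P : Orders → Prop} {a a' b b' : ℕ} {s s₁ s' : GameState}

theorem refl (s : GameState) : CanReach W P 0 0 s s :=
  ⟨[], List.forall_mem_nil P, .nil s, le_rfl, le_rfl⟩

theorem trans (h : CanReach W P a b s s₁) (h' : CanReach W P a' b' s₁ s') :
    CanReach W P (a + a') (b + b') s s' := by
  obtain ⟨os, hP, hplay, hlen, hwork⟩ := h
  obtain ⟨os', hP', hplay', hlen', hwork'⟩ := h'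
  refine ⟨os ++ os', List.forall_mem_append.mpr ⟨hP, hP'⟩, hplay.append hplay', ?_, ?_⟩
  · rw [List.length_append]
    exact Nat.add_le_add hlen hlen'
  · rw [List.filter_append, List.length_append]
    exact Nat.add_le_add hwork hwork'

theorem mono (h : CanReach W P a b s s') (ha : a ≤ a') (hb : b ≤ b') :
    CanReach W P a' b' s s' :=
  let ⟨os, hP, hplay, hlen, hwork⟩ := h
  ⟨os, hP, hplay, hlen.trans ha, hwork.trans hb⟩

theorem of_turn {o : Orders} (hP : P o) (h : Turn W s o s') : CanReach W P 1 1 s s' :=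
  ⟨[o], List.forall_mem_singleton.mpr hP, .single h, le_rfl, List.length_filter_le _ _⟩

theorem of_turn_not_isWork {o : Orders} (hP : P o) (ho : o.isWork = false) (h : Turn W s o s') :
    CanReach W P 1 0 s s' :=
  ⟨[o], List.forall_mem_singleton.mpr hP, .single h, le_rfl, by simp [ho]⟩

theorem build {t : Tile} {k : Build} {o : Orders} (hP : P o)
    (ho : ∀ B B', Works W t (.build k) B B' → Turn W { s with board := B } o { s with board := B' })
    (hpos : 1 ≤ W.turns k) {B : Board} (hB : W.CanBuild B t k) :
    ∃ B', CanReach W P (W.turns k) (W.turns k) { s with board := B } { s with board := B' } ∧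
      B'.improvement = Function.update B.improvement t k.result := by
  suffices ∀ n, ∀ B : Board, W.CanBuild B t k → W.turns k ≤ B.progress t k + (n + 1) →
      ∃ B', CanReach W P (n + 1) (n + 1) { s with board := B } { s with board := B' } ∧
        B'.improvement = Function.update B.improvement t k.result by
    have := this (W.turns k - 1) B hB
    rw [Nat.sub_add_cancel hpos] at this
    exact this (Nat.le_add_left _ _)
  intro n
  induction n with
  | zero => exact fun B hB hn => ⟨_, of_turn hP (ho _ _ (.finish B k hB hn)), rfl⟩
  | succ n ih =>
    intro B hB hn
    rcases lt_or_ge (B.progress t k + 1) (W.turns k) with hlt | hge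
    · let B₁ := B.setProgress t k (B.progress t k + 1)
      have hB₁ : W.CanBuild B₁ t k := by cases k <;> exact hB
      have hprogress : B₁.progress t k = B.progress t k + 1 := by simp [B₁, Board.setProgress]
      obtain ⟨B', hreach, himprovement⟩ := ih B₁ hB₁ (by lia)
      exact ⟨B', ((of_turn hP (ho _ _ (.goOn B k hB hlt))).trans hreach).mono
        (Nat.add_comm _ _).le (Nat.add_comm _ _).le, himprovement⟩
    · exact ⟨_, (of_turn hP (ho _ _ (.finish B k hB hge))).mono
        (Nat.le_add_left _ _) (Nat.le_add_left _ _), rfl⟩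

end CanReach

/-! ### Game states that represent configurations -/

variable {W : World} {s : GameState} {n : ℕ} {τ : ℤ → TileSymbol} {i : ℤ}

open Classical in
/-- The tiles of the state section with a Terrascape. -/
noncomputable def World.terrascapes (W : World) (B : Board) : Finset Tile :=
  {t ∈ W.stateSection ∩ W.worked | B.improvement t = .terrascape}

theorem World.mem_terrascapes {B : Board} {t : Tile} :
    t ∈ W.terrascapes B ↔
      t ∈ W.stateSection ∩ W.worked ∧ B.improvement t = .terrascape :=
  Finset.mem_filter

theorem World.terrascapes_eq_insert {B B' : Board} {t : Tile}
    (ht : t ∈ W.stateSection ∩ W.worked)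
    (hB : B'.improvement = Function.update B.improvement t .terrascape) :
    W.terrascapes B' = insert t (W.terrascapes B) := by
  ext u
  rcases eq_or_ne u t with rfl | hne
  · simp [mem_terrascapes, hB, Finset.mem_inter.mp ht]
  · simp [mem_terrascapes, hB, hne]

theorem World.terrascapes_eq_erase {B B' : Board} {t : Tile}
    (hB : B'.improvement = Function.update B.improvement t .none) :
    W.terrascapes B' = (W.terrascapes B).erase t := by
  ext u
  rcases eq_or_ne u t with rfl | hne
  · simp [mem_terrascapes, hB]
  · simp [mem_terrascapes, hB, hne]

theorem TileSymbol.improvement_ne_terrascape (a : TileSymbol) : a.improvement ≠ .terrascape := by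
  cases a <;> exact Improvement.noConfusion

/-- The game state `s` has `n` Terrascapes, the symbols `τ` on the strip, and the head on
tile `i` of it. Unlike in `Represents`, the number of Terrascapes is not bounded by the states
of the machine, and it is counted instead of being read off the Culture yield. -/
structure Holds (W : World) (s : GameState) (n : ℕ) (τ : ℤ → TileSymbol) (i : ℤ) : Prop where
  card_eq : (W.terrascapes s.board).card = n
  tape_eq : ∀ i, s.board.improvement (W.strip i) = (τ i).improvement
  tapeWorker_eq : s.tapeWorker = W.strip i
  rover_eq : s.rover = W.strip i
  stateWorker_mem : s.stateWorker ∈ W.stateSection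
  terrascape_mem : ∀ t, s.board.improvement t = .terrascape → t ∈ W.stateSection ∩ W.worked
  stateTile : ∀ t ∈ W.stateSection ∩ W.worked,
    s.board.improvement t = .none ∨ s.board.improvement t = .terrascape

theorem normalizedCulture_eq_card_terrascapes (hW : W.Suitable)
    (h : ∀ t, s.board.improvement t = .terrascape → t ∈ W.stateSection ∩ W.worked) :
    W.normalizedCulture s = ((W.terrascapes s.board).card : ℚ) := by
  classical
  have hyield : W.terrascapeYield .desert ≠ 0 := by
    simp [World.terrascapeYield, hW.has_ecoscaping]
  have hfilter : {t ∈ W.worked | s.board.improvement t = .terrascape} =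
      W.terrascapes s.board := by
    ext t
    rw [Finset.mem_filter, World.mem_terrascapes]
    exact ⟨fun ht => ⟨h t ht.2, ht.2⟩, fun ht => ⟨Finset.mem_of_mem_inter_right ht.1, ht.2⟩⟩
  have hdesert : ∀ t ∈ W.terrascapes s.board, W.terrascapeYield (W.terrain t) =
      W.terrascapeYield .desert := fun t ht => by
    rw [hW.section_desert t (Finset.mem_of_mem_inter_left (World.mem_terrascapes.mp ht).1)]
  have hculture : W.culture s =
      W.baseCulture + (W.terrascapes s.board).card * W.terrascapeYield .desert := by
    rw [World.culture, ← Finset.sum_filter, hfilter, Finset.sum_congr rfl hdesert,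
      Finset.sum_const, smul_eq_mul]
  rw [World.normalizedCulture, hculture, Nat.cast_add, Nat.cast_mul, add_sub_cancel_left,
    mul_div_cancel_right₀ _ (Nat.cast_ne_zero.mpr hyield)]

theorem Represents.holds (hW : W.Suitable) {c : Cfg (Fin 10) TileSymbol} (h : Represents W s c) :
    Holds W s c.state.val c.tape c.head where
  card_eq := Nat.cast_injective
    ((normalizedCulture_eq_card_terrascapes hW h.terrascape_mem).symm.trans h.state_eq)
  __ := h

namespace Holds

theorem represents (hW : W.Suitable) {q : Fin 10} (h : Holds W s q.val τ i) :
    Represents W s ⟨q, i, τ⟩ where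
  state_eq := by rw [normalizedCulture_eq_card_terrascapes hW h.terrascape_mem, h.card_eq]
  __ := h

theorem write (hW : W.Suitable) (h : Holds W s n τ i) {B : Board} {a : TileSymbol}
    (hB : B.improvement = Function.update s.board.improvement (W.strip i) a.improvement) :
    Holds W { s with board := B } n (Function.update τ i a) i := by
  have hsection : ∀ t ∈ W.stateSection ∩ W.worked, B.improvement t = s.board.improvement t := by
    intro t ht
    rw [hB, Function.update_of_ne]
    rintro rfl
    exact hW.section_disjoint i (Finset.mem_of_mem_inter_left ht)
  have hterrascapes : W.terrascapes B = W.terrascapes s.board :=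
    Finset.filter_congr fun t ht => by rw [hsection t ht]
  exact {
    card_eq := by rw [hterrascapes, h.card_eq]
    tape_eq := fun j => by
      rw [hB]
      rcases eq_or_ne j i with rfl | hj
      · rw [Function.update_self, Function.update_self]
      · rw [Function.update_of_ne (hW.strip_injective.ne hj), Function.update_of_ne hj, h.tape_eq]
    tapeWorker_eq := h.tapeWorker_eq
    rover_eq := h.rover_eq
    stateWorker_mem := h.stateWorker_mem
    terrascape_mem := fun t ht => by
      rw [hB] at ht
      rcases eq_or_ne t (W.strip i) with rfl | hne
      · rw [Function.update_self] at ht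
        exact absurd ht a.improvement_ne_terrascape
      · rw [Function.update_of_ne hne] at ht
        exact h.terrascape_mem t ht
    stateTile := fun t ht => by
      rw [hsection t ht]
      exact h.stateTile t ht }

theorem setStateTile (hW : W.Suitable) (h : Holds W s n τ i) {B : Board} {a : Improvement}
    {t : Tile} (ht : t ∈ W.stateSection ∩ W.worked) (ha : a = .none ∨ a = .terrascape)
    (hB : B.improvement = Function.update s.board.improvement t a) :
    Holds W { s with board := B } (W.terrascapes B).card τ i where
  card_eq := rfl
  tape_eq j := by
    rw [hB, Function.update_of_ne, h.tape_eq]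
    rintro rfl
    exact hW.section_disjoint j (Finset.mem_of_mem_inter_left ht)
  tapeWorker_eq := h.tapeWorker_eq
  rover_eq := h.rover_eq
  stateWorker_mem := h.stateWorker_mem
  terrascape_mem u hu := by
    rcases eq_or_ne u t with rfl | hne
    · exact ht
    · rw [hB, Function.update_of_ne hne] at hu
      exact h.terrascape_mem u hu
  stateTile u hu := by
    rw [hB]
    rcases eq_or_ne u t with rfl | hne
    · rwa [Function.update_self]
    · rw [Function.update_of_ne hne]
      exact h.stateTile u hu

theorem addTerrascape (hW : W.Suitable) (h : Holds W s n τ i) {B : Board} {t : Tile}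
    (ht : t ∈ W.stateSection ∩ W.worked) (hnone : s.board.improvement t = .none)
    (hB : B.improvement = Function.update s.board.improvement t .terrascape) :
    Holds W { s with board := B } (n + 1) τ i := by
  have hmem : t ∉ W.terrascapes s.board := by simp [World.mem_terrascapes, hnone]
  have hcard : (W.terrascapes B).card = n + 1 := by
    rw [World.terrascapes_eq_insert ht hB, Finset.card_insert_of_notMem hmem, h.card_eq]
  exact hcard ▸ h.setStateTile hW ht (.inr rfl) hB

theorem removeTerrascape (hW : W.Suitable) (h : Holds W s (n + 1) τ i) {B : Board} {t : Tile}
    (ht : t ∈ W.terrascapes s.board)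
    (hB : B.improvement = Function.update s.board.improvement t .none) :
    Holds W { s with board := B } n τ i := by
  have hcard : (W.terrascapes B).card = n := by
    rw [World.terrascapes_eq_erase hB, Finset.card_erase_of_mem ht, h.card_eq, Nat.add_sub_cancel]
  exact hcard ▸ h.setStateTile hW (World.mem_terrascapes.mp ht).1 (.inl rfl) hB

theorem setStateWorker (h : Holds W s n τ i) {t : Tile} (ht : t ∈ W.stateSection) :
    Holds W { s with stateWorker := t } n τ i :=
  { h with stateWorker_mem := ht }

theorem tapeWorker_notMem (hW : W.Suitable) (h : Holds W s n τ i) :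
    s.tapeWorker ∉ W.stateSection :=
  h.tapeWorker_eq ▸ hW.section_disjoint i

theorem stateWorker_ne (hW : W.Suitable) (h : Holds W s n τ i) : s.stateWorker ≠ s.tapeWorker :=
  ne_of_mem_of_not_mem h.stateWorker_mem (h.tapeWorker_notMem hW)

theorem improvement_tapeWorker (h : Holds W s n τ i) :
    s.board.improvement s.tapeWorker = (τ i).improvement := by
  rw [h.tapeWorker_eq, h.tape_eq]

end Holds

variable {m r : ℕ} {P : Orders → Prop}

/-! ### Moves -/

theorem Adjacent.symm {t t' : Tile} (h : Adjacent t t') : Adjacent t' t := by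
  simp only [Adjacent, Set.mem_insert_iff, Set.mem_singleton_iff, Prod.mk.injEq] at h ⊢
  lia

theorem World.Suitable.canMove_strip (hW : W.Suitable) (d : Dir) (i : ℤ) :
    W.CanMove (W.strip i) (W.strip (d.shift i)) := by
  refine .inr ⟨?_, hW.strip_traversable _⟩
  cases d with
  | L => simpa [Dir.shift] using (hW.strip_adjacent (i - 1)).symm
  | R => exact hW.strip_adjacent i

theorem Holds.moveHead (hW : W.Suitable) (h : Holds W s n τ i) (d : Dir)
    (hP : P ⟨.idle, .idle, false⟩) :
    ∃ s', CanReach W P 1 0 s s' ∧ Holds W s' n τ (d.shift i) := by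
  let s' := { s with tapeWorker := W.strip (d.shift i), rover := W.strip (d.shift i) }
  have h' : Holds W s' n τ (d.shift i) := { h with tapeWorker_eq := rfl, rover_eq := rfl }
  have hmove := hW.canMove_strip d i
  exact ⟨s', .of_turn_not_isWork hP rfl ⟨.inl rfl, h.tapeWorker_eq ▸ hmove, h.rover_eq ▸ hmove,
    h'.stateWorker_ne hW, _, _, .idle _, .idle _, .idle _⟩, h'⟩

theorem exists_canReach_stateWorker (hW : W.Suitable) {t t' : Tile}
    (h : Relation.ReflTransGen (fun u v => Adjacent u v ∧ v ∈ W.stateSection) t t') :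
    ∃ m, ∀ (P : Orders → Prop) (s : GameState), P ⟨.idle, .idle, false⟩ → s.stateWorker = t →
      s.tapeWorker ∉ W.stateSection → CanReach W P m 0 s { s with stateWorker := t' } := by
  induction h with
  | refl => exact ⟨0, by rintro P s - rfl -; exact .refl s⟩
  | @tail u v _ huv ih =>
    obtain ⟨hadj, hv⟩ := huv
    obtain ⟨m, hm⟩ := ih
    refine ⟨m + 1, fun P s hP hs hs' => (hm P s hP hs hs').trans (b' := 0) ?_⟩
    exact .of_turn_not_isWork hP rfl ⟨.inr ⟨hadj, hW.section_traversable v hv⟩, .inl rfl, .inl rfl,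
      ne_of_mem_of_not_mem hv hs', _, _, .idle _, .idle _, .idle _⟩

/-- The state Worker can always reach every tile of the state section within `m` turns, by orders
to do nothing but move. -/
def WalkBound (W : World) (m : ℕ) : Prop :=
  ∀ (P : Orders → Prop) (s : GameState), P ⟨.idle, .idle, false⟩ →
    s.stateWorker ∈ W.stateSection → s.tapeWorker ∉ W.stateSection →
    ∀ t ∈ W.stateSection, CanReach W P m 0 s { s with stateWorker := t }

theorem exists_walkBound (hW : W.Suitable) : ∃ m, WalkBound W m := by
  choose! f hf using fun (t : Tile) (ht : t ∈ W.stateSection) (t' : Tile)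
    (ht' : t' ∈ W.stateSection) => exists_canReach_stateWorker hW (hW.section_connected t ht t' ht')
  refine ⟨(W.stateSection ×ˢ W.stateSection).sup fun x => f x.1 x.2, fun P s hP hs hs' t ht => ?_⟩
  exact (hf _ hs t ht P s hP rfl hs').mono
    (Finset.le_sup (f := fun x : Tile × Tile => f x.1 x.2) (Finset.mk_mem_product hs ht)) le_rfl

/-! ### Work on the tape -/

theorem turn_tapeWorker {j : Job} {B : Board} (h : s.stateWorker ≠ s.tapeWorker)
    (hB : Works W s.tapeWorker j s.board B) :
    Turn W s ⟨.idle, j, false⟩ { s with board := B } :=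
  ⟨.inl rfl, .inl rfl, .inl rfl, h, _, _, .idle _, hB, .idle _⟩

theorem turn_stateWorker {j : Job} {B : Board} (h : s.stateWorker ≠ s.tapeWorker)
    (hB : Works W s.stateWorker j s.board B) :
    Turn W s ⟨j, .idle, false⟩ { s with board := B } :=
  ⟨.inl rfl, .inl rfl, .inl rfl, h, _, _, .idle _, .idle _, hB⟩

theorem turn_rover (h : s.stateWorker ≠ s.tapeWorker) (hs : s.board.improvement s.rover = .road) :
    Turn W s ⟨.idle, .idle, true⟩ { s with board := s.board.set s.rover .pillagedRoad } :=
  ⟨.inl rfl, .inl rfl, .inl rfl, h, _, _, .pillage _ hs, .idle _, .idle _⟩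

namespace Holds

theorem buildRoad (hW : W.Suitable) (h : Holds W s n τ i) (ha : τ i = 𝟎)
    (hP : P ⟨.idle, .build .road, false⟩) :
    ∃ s', CanReach W P W.roadTurns W.roadTurns s s' ∧ Holds W s' n (Function.update τ i 𝟏) i := by
  have hB : W.CanBuild s.board s.tapeWorker .road := by
    rw [World.CanBuild, h.improvement_tapeWorker, ha, TileSymbol.improvement]
  have hne := h.stateWorker_ne hW
  obtain ⟨B, hreach, himprovement⟩ := CanReach.build (s := s) hP
    (fun B _ => turn_tapeWorker (s := { s with board := B }) hne) hW.roadTurns_pos hB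
  exact ⟨_, hreach, h.write hW (h.tapeWorker_eq ▸ himprovement)⟩

theorem repairRoad (hW : W.Suitable) (h : Holds W s n τ i) (ha : τ i = 𝐛)
    (hP : P ⟨.idle, .repair, false⟩) :
    ∃ s', CanReach W P 1 1 s s' ∧ Holds W s' n (Function.update τ i 𝟏) i := by
  have hs : s.board.improvement s.tapeWorker = .pillagedRoad := by
    rw [h.improvement_tapeWorker, ha, TileSymbol.improvement]
  exact ⟨_, .of_turn hP (turn_tapeWorker (h.stateWorker_ne hW) (.repair _ hs)),
    h.write hW (h.tapeWorker_eq ▸ rfl)⟩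

theorem removeImprovement (hW : W.Suitable) (h : Holds W s n τ i) (ha : τ i ≠ 𝟎)
    (hP : P ⟨.idle, .remove, false⟩) :
    ∃ s', CanReach W P 1 1 s s' ∧ Holds W s' n (Function.update τ i 𝟎) i := by
  have hs : s.board.improvement s.tapeWorker ≠ .none := by
    rw [h.improvement_tapeWorker]
    cases e : τ i with
    | noImprovement => exact absurd e ha
    | road | pillagedRoad => exact Improvement.noConfusion
  exact ⟨_, .of_turn hP (turn_tapeWorker (h.stateWorker_ne hW) (.remove _ hs)),
    h.write hW (h.tapeWorker_eq ▸ rfl)⟩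

theorem pillageRoad (hW : W.Suitable) (h : Holds W s n τ i) (ha : τ i = 𝟏)
    (hP : P ⟨.idle, .idle, true⟩) :
    ∃ s', CanReach W P 1 1 s s' ∧ Holds W s' n (Function.update τ i 𝐛) i := by
  have hs : s.board.improvement s.rover = .road := by
    rw [h.rover_eq, h.tape_eq, ha, TileSymbol.improvement]
  exact ⟨_, .of_turn hP (turn_rover (h.stateWorker_ne hW) hs), h.write hW (h.rover_eq ▸ rfl)⟩

end Holds

/-- The tape command can be executed where the head reads `a`. -/
def TapeCommand.Fits : TapeCommand → TileSymbol → Prop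
  | .leave, _ => True
  | .buildRoad, a => a = 𝟎
  | .buildRoadAndPillage, a => a = 𝟎
  | .pillageRoad, a => a = 𝟏
  | .repairRoad, a => a = 𝐛
  | .removeImprovement, a => a ≠ 𝟎

/-- The number of turns of work for a tape command, where a Road takes `M` turns. -/
def TapeCommand.workTurns (M : ℕ) : TapeCommand → ℕ
  | .leave => 0
  | .buildRoad => M
  | .buildRoadAndPillage => M + 1
  | .pillageRoad => 1
  | .repairRoad => 1
  | .removeImprovement => 1

theorem TapeCommand.workTurns_le {M : ℕ} (k : TapeCommand) : k.workTurns M ≤ M + 1 := by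
  cases k <;> simp only [workTurns] <;> lia

theorem TapeCommand.permits_idle (k : TapeCommand) : k.Permits .idle false := by
  cases k <;> simp [TapeCommand.Permits]

theorem StateCommand.permits_idle (k : StateCommand) : k.Permits .idle := by
  cases k <;> simp [StateCommand.Permits]

theorem Command.permits_idle (k : Command) : k.Permits ⟨.idle, .idle, false⟩ :=
  ⟨k.tape.permits_idle, k.state.permits_idle⟩

theorem Holds.tapeCommand (hW : W.Suitable) (h : Holds W s n τ i) {k : Command}
    (hk : k.tape.Fits (τ i)) :
    ∃ s', CanReach W k.Permits (k.tape.workTurns W.roadTurns) (k.tape.workTurns W.roadTurns) s s' ∧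
      Holds W s' n (Function.update τ i (k.tape.write (τ i))) i := by
  obtain ⟨t, d, u⟩ := k
  have hu := u.permits_idle
  cases t with
  | leave => exact ⟨s, .refl s, by simpa [TapeCommand.write] using h⟩
  | buildRoad => exact h.buildRoad hW hk ⟨⟨.inr rfl, rfl⟩, hu⟩
  | buildRoadAndPillage =>
    obtain ⟨s₁, hroad, h₁⟩ := h.buildRoad (P := Command.Permits ⟨.buildRoadAndPillage, d, u⟩) hW hk
      ⟨.inr rfl, hu⟩
    obtain ⟨s₂, hpillage, h₂⟩ := h₁.pillageRoad (P := Command.Permits ⟨.buildRoadAndPillage, d, u⟩)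
      hW (Function.update_self ..) ⟨.inl rfl, hu⟩
    exact ⟨s₂, hroad.trans hpillage, by simpa [TapeCommand.write] using h₂⟩
  | pillageRoad => exact h.pillageRoad hW hk ⟨rfl, hu⟩
  | repairRoad => exact h.repairRoad hW hk ⟨⟨.inr rfl, rfl⟩, hu⟩
  | removeImprovement => exact h.removeImprovement hW hk ⟨⟨.inr rfl, rfl⟩, hu⟩

/-! ### Work on the state section -/

namespace Holds

theorem encard_terrascapes (h : Holds W s n τ i) :
    {t | s.board.improvement t = .terrascape}.encard = n := by
  have : {t | s.board.improvement t = .terrascape} = (W.terrascapes s.board : Set Tile) := by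
    ext t
    rw [Finset.mem_coe, World.mem_terrascapes]
    exact ⟨fun ht => ⟨h.terrascape_mem t ht, ht⟩, And.right⟩
  rw [this, Set.encard_coe_eq_coe_finsetCard, h.card_eq]

theorem exists_unimproved (hW : W.Suitable) (h : Holds W s n τ i) (hn : n < 9) :
    ∃ t ∈ W.stateSection ∩ W.worked, s.board.improvement t = .none := by
  obtain ⟨t, ht, hnot⟩ := Finset.exists_mem_notMem_of_card_lt_card
    (h.card_eq.trans_lt (hn.trans_le hW.nine_worked))
  exact ⟨t, ht, (h.stateTile t ht).resolve_right fun e => hnot (World.mem_terrascapes.mpr ⟨ht, e⟩)⟩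

theorem buildTerrascape (hW : W.Suitable) (hm : WalkBound W m) (h : Holds W s n τ i) (hn : n < 9)
    (hidle : P ⟨.idle, .idle, false⟩) (hP : P ⟨.build .terrascape, .idle, false⟩) :
    ∃ s', CanReach W P (m + W.terrascapeTurns) W.terrascapeTurns s s' ∧
      Holds W s' (n + 1) τ i := by
  obtain ⟨t, ht, hnone⟩ := h.exists_unimproved hW hn
  have hsection := Finset.mem_of_mem_inter_left ht
  have hwalk := hm P s hidle h.stateWorker_mem (h.tapeWorker_notMem hW) t hsection
  have h₁ := h.setStateWorker hsection
  have hB : W.CanBuild s.board t .terrascape := by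
    refine ⟨hnone, hW.section_owned t hsection, hW.has_terraforming, ?_⟩
    rw [h.encard_terrascapes]
    exact_mod_cast hn.trans_le hW.nine_maintainable
  have hne := h₁.stateWorker_ne hW
  obtain ⟨B, hbuild, himprovement⟩ := CanReach.build (s := { s with stateWorker := t }) hP
    (fun B _ => turn_stateWorker (s := { s with stateWorker := t, board := B }) hne)
    hW.terrascapeTurns_pos hB
  exact ⟨_, (hwalk.trans hbuild).mono le_rfl (zero_add _).le,
    h₁.addTerrascape hW ht hnone himprovement⟩

theorem demolishTerrascape (hW : W.Suitable) (hm : WalkBound W m) (h : Holds W s (n + 1) τ i)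
    (hidle : P ⟨.idle, .idle, false⟩) (hP : P ⟨.remove, .idle, false⟩) :
    ∃ s', CanReach W P (m + 1) 1 s s' ∧ Holds W s' n τ i := by
  obtain ⟨t, ht⟩ : (W.terrascapes s.board).Nonempty :=
    Finset.card_pos.mp (h.card_eq.symm ▸ Nat.succ_pos n)
  obtain ⟨hmem, hterrascape⟩ := World.mem_terrascapes.mp ht
  have hsection := Finset.mem_of_mem_inter_left hmem
  have hwalk := hm P s hidle h.stateWorker_mem (h.tapeWorker_notMem hW) t hsection
  have h₁ := h.setStateWorker hsection
  have hne : s.board.improvement t ≠ .none := hterrascape ▸ Improvement.noConfusion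
  have hremove := turn_stateWorker (W := W) (s := { s with stateWorker := t })
    (h₁.stateWorker_ne hW) (.remove _ hne)
  exact ⟨_, (hwalk.trans (.of_turn hP hremove)).mono le_rfl le_rfl,
    h₁.removeTerrascape hW ht rfl⟩

theorem buildTerrascapes (hW : W.Suitable) (hm : WalkBound W m) (h : Holds W s n τ i)
    (hr : n + r ≤ 9) (hidle : P ⟨.idle, .idle, false⟩)
    (hP : P ⟨.build .terrascape, .idle, false⟩) :
    ∃ s', CanReach W P (r * (m + W.terrascapeTurns)) (r * W.terrascapeTurns) s s' ∧
      Holds W s' (n + r) τ i := by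
  induction r with
  | zero => exact ⟨s, by simpa using CanReach.refl s, h⟩
  | succ r ih =>
    obtain ⟨s₁, hreach₁, h₁⟩ := ih (by lia)
    obtain ⟨s₂, hreach₂, h₂⟩ := h₁.buildTerrascape hW hm (by lia) hidle hP
    rw [add_one_mul, add_one_mul]
    exact ⟨s₂, hreach₁.trans hreach₂, h₂⟩

theorem demolishTerrascapes (hW : W.Suitable) (hm : WalkBound W m) (h : Holds W s (n + r) τ i)
    (hidle : P ⟨.idle, .idle, false⟩) (hP : P ⟨.remove, .idle, false⟩) :
    ∃ s', CanReach W P (r * (m + 1)) r s s' ∧ Holds W s' n τ i := by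
  induction r generalizing s with
  | zero => exact ⟨s, by simpa using CanReach.refl s, h⟩
  | succ r ih =>
    obtain ⟨s₁, hreach₁, h₁⟩ := demolishTerrascape hW hm h hidle hP
    obtain ⟨s₂, hreach₂, h₂⟩ := ih h₁
    rw [add_one_mul, add_comm, add_comm r]
    exact ⟨s₂, hreach₁.trans hreach₂, h₂⟩

end Holds

/-- The state command can be executed in state `q`, and it asks for at most 5 Terrascapes. -/
def StateCommand.Fits : StateCommand → ℕ → Prop
  | .noBuild, _ => True
  | .build n, q => q + n ≤ 9 ∧ n ≤ 5
  | .remove n, q => n ≤ q ∧ n ≤ 5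

/-- The number of turns of work for a state command, where a Terrascape takes `T` turns. -/
def StateCommand.workTurns (T : ℕ) : StateCommand → ℕ
  | .noBuild => 0
  | .build n => n * T
  | .remove n => n

theorem Holds.stateCommand (hW : W.Suitable) (hm : WalkBound W m) {q : Fin 10}
    (h : Holds W s q.val τ i) {k : Command} (hk : k.state.Fits q.val) :
    ∃ s', CanReach W k.Permits (5 * (m + W.terrascapeTurns))
        (k.state.workTurns W.terrascapeTurns) s s' ∧
      Holds W s' (k.state.apply q).val τ i := by
  obtain ⟨t, d, u⟩ := k
  have ht := t.permits_idle
  cases u with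
  | noBuild => exact ⟨s, (CanReach.refl s).mono (Nat.zero_le _) le_rfl, h⟩
  | build r =>
    obtain ⟨hqr, hr⟩ : q.val + r ≤ 9 ∧ r ≤ 5 := hk
    obtain ⟨s', hreach, hs⟩ := h.buildTerrascapes (P := Command.Permits ⟨t, d, .build r⟩) hW hm hqr
      ⟨ht, .inl rfl⟩ ⟨ht, .inr rfl⟩
    refine ⟨s', hreach.mono (Nat.mul_le_mul_right _ hr) le_rfl, ?_⟩
    simpa [StateCommand.apply, Nat.mod_eq_of_lt (Nat.lt_succ_of_le hqr)] using hs
  | remove r =>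
    obtain ⟨hrq, hr⟩ : r ≤ q.val ∧ r ≤ 5 := hk
    rw [← Nat.sub_add_cancel hrq] at h
    obtain ⟨s', hreach, hs⟩ := h.demolishTerrascapes (P := Command.Permits ⟨t, d, .remove r⟩) hW hm
      ⟨ht, .inl rfl⟩ ⟨ht, .inr rfl⟩
    refine ⟨s', hreach.mono
      (Nat.mul_le_mul hr (Nat.add_le_add_left hW.terrascapeTurns_pos m)) le_rfl, ?_⟩
    simpa [StateCommand.apply, Nat.mod_eq_of_lt ((Nat.sub_le q.val r).trans_lt q.isLt)] using hs

/-! ### Execution of the command table -/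

theorem fits_of_table_eq_some {q : Fin 10} {a : TileSymbol} {k : Command}
    (h : table q a = some k) : k.tape.Fits a ∧ k.state.Fits q.val := by
  cases a <;> fin_cases q <;> cases h <;> simp [TapeCommand.Fits, StateCommand.Fits]

theorem workTurns_add_workTurns_le {q : Fin 10} {a : TileSymbol} {k : Command}
    (h : table q a = some k) {M T : ℕ} (hM : 1 ≤ M) (hT : 1 ≤ T) :
    k.tape.workTurns M + k.state.workTurns T ≤ 5 * T + M := by
  cases a <;> fin_cases q <;> cases h <;>
    simp only [TapeCommand.workTurns, StateCommand.workTurns] <;> lia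

theorem exists_canReach_of_step (hW : W.Suitable) :
    ∃ K, ∀ (s : GameState) (c c' : Cfg (Fin 10) TileSymbol),
      Represents W s c → civMachine.step c = some c' →
      ∃ k s', table c.state (c.tape c.head) = some k ∧
        CanReach W k.Permits K (5 * W.terrascapeTurns + W.roadTurns) s s' ∧
        Represents W s' c' := by
  obtain ⟨m, hm⟩ := exists_walkBound hW
  refine ⟨W.roadTurns + 1 + 1 + 5 * (m + W.terrascapeTurns), fun s c c' h hc => ?_⟩
  obtain ⟨q, i, τ⟩ := c
  simp only [TuringMachine.step, civMachine, Option.map_map, Option.map_eq_some_iff] at hc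
  obtain ⟨k, hk, rfl⟩ := hc
  obtain ⟨htape, hstate⟩ := fits_of_table_eq_some hk
  obtain ⟨s₁, hreach₁, h₁⟩ := (h.holds hW).tapeCommand hW htape
  obtain ⟨s₂, hreach₂, h₂⟩ := h₁.moveHead hW k.dir k.permits_idle
  obtain ⟨s₃, hreach₃, h₃⟩ := h₂.stateCommand hW hm hstate
  exact ⟨k, s₃, hk, ((hreach₁.trans hreach₂).trans hreach₃).mono
    (Nat.add_le_add_right (Nat.add_le_add_right k.tape.workTurns_le 1) _)
    (workTurns_add_workTurns_le hk hW.roadTurns_pos hW.terrascapeTurns_pos), h₃.represents hW⟩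

theorem exists_represents_init (hW : W.Suitable) (x : List TileSymbol × List TileSymbol) :
    ∃ s : GameState, Represents W s (civMachine.init x) ∧
      ∀ t ∈ W.stateSection, s.board.improvement t = .none := by
  obtain ⟨t₀, ht₀⟩ : (W.stateSection ∩ W.worked).Nonempty :=
    Finset.card_pos.mp (Nat.zero_lt_of_lt hW.nine_worked)
  let τ := (civMachine.init x).tape
  let g : Tile → Improvement :=
    Function.extend W.strip (fun i => (τ i).improvement) fun _ => .none
  have hstrip (i : ℤ) : g (W.strip i) = (τ i).improvement := hW.strip_injective.extend_apply ..
  have hnone (t : Tile) (ht : t ∉ Set.range W.strip) : g t = .none :=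
    Function.extend_apply' _ _ _ ht
  have hsection (t : Tile) (ht : t ∈ W.stateSection) : g t = .none :=
    hnone t fun ⟨i, hi⟩ => hW.section_disjoint i (hi ▸ ht)
  have hterrascape (t : Tile) : g t ≠ .terrascape := by
    by_cases ht : t ∈ Set.range W.strip
    · obtain ⟨i, rfl⟩ := ht
      exact hstrip i ▸ (τ i).improvement_ne_terrascape
    · exact hnone t ht ▸ Improvement.noConfusion
  refine ⟨⟨⟨g, fun _ _ => 0⟩, t₀, W.strip 0, W.strip 0⟩, ?_, hsection⟩
  refine Holds.represents hW (q := 0) {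
    card_eq := Finset.card_eq_zero.mpr (Finset.filter_false_of_mem fun t _ => hterrascape t)
    tape_eq := hstrip
    tapeWorker_eq := rfl
    rover_eq := rfl
    stateWorker_mem := Finset.mem_of_mem_inter_left ht₀
    terrascape_mem := fun t ht => absurd ht (hterrascape t)
    stateTile := fun t ht => .inl (hsection t (Finset.mem_of_mem_inter_left ht)) }

end Game

end CivBE

theorem theorem1 (W : CivBE.World) (hW : W.Suitable) :
    -- the machine of the command table is a (10, 3)-universal Turing machine
    CivBE.IsUTM 10 3 CivBE.civMachine ∧
    -- its transition table is, entry by entry, that of Rogozhin's machine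
    (∀ (q : Fin 10) (a : CivBE.TileSymbol),
      CivBE.rogozhin.δ q (CivBE.TileSymbol.equivRSymbol a) =
        (CivBE.civMachine.δ q a).map
          fun (q', a', d) => (q', CivBE.TileSymbol.equivRSymbol a', d)) ∧
    -- every initial configuration is represented by a state of the game, with the state
    -- section unimproved
    (∀ x : List CivBE.TileSymbol × List CivBE.TileSymbol, ∃ s : CivBE.GameState,
      CivBE.Represents W s (CivBE.civMachine.init x) ∧
        ∀ t ∈ W.stateSection, s.board.improvement t = CivBE.Improvement.none) ∧
    -- the game executes every step of the machine by the commands of the table, in a bounded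
    -- number of turns, of which at most `5T + M` are spent on work
    ∃ K : ℕ, ∀ (s : CivBE.GameState) (c c' : CivBE.Cfg (Fin 10) CivBE.TileSymbol),
      CivBE.Represents W s c → CivBE.civMachine.step c = some c' →
      ∃ (k : CivBE.Command) (os : List CivBE.Orders) (s' : CivBE.GameState),
        CivBE.table c.state (c.tape c.head) = some k ∧
        (∀ o ∈ os, k.Permits o) ∧
        CivBE.Play W s os s' ∧ CivBE.Represents W s' c' ∧
        os.length ≤ K ∧
        (os.filter CivBE.Orders.isWork).length ≤ 5 * W.terrascapeTurns + W.roadTurns := by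
  obtain ⟨K, hK⟩ := CivBE.exists_canReach_of_step hW
  refine ⟨CivBE.isUTM_civMachine, CivBE.rogozhin_δ, CivBE.exists_represents_init hW, K,
    fun s c c' h hc => ?_⟩
  obtain ⟨k, s', hk, ⟨os, hP, hplay, hlen, hwork⟩, h'⟩ := hK s c c' h hc
  exact ⟨k, os, s', hk, hP, hplay, h', hlen, hwork⟩
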